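/- Let $L>0$ and let $f_1,f_2\in C^\infty(\mathbb R)$ satisfy $f_1<f_2$ on $\mathbb R$ and $f_1(t)=-1$, $f_2(t)=1$ for $|t|\ge L$. Put $\Omega=\{(x_1,x_2)\in\mathbb R^2:\ f_1(x_1)<x_2<f_2(x_1)\}$ and let $\mathbf n$ be the outer unit normal on $\partial\Omega$. Let $H_\sigma(\Omega)$ be the closure, in the $H^1(\Omega)$ norm, of the set of vector fields $\mathbf u\in C^\infty(\overline\Omega)\cap H^1(\Omega)$ with values in $\mathbb R^2$, $\operatorname{div}\mathbf u=0$ in $\Omega$ and $\mathbf u\cdot\mathbf n=0$ on $\partial\Omega$. For all $\varepsilon>0$ and $\mathfrak d>0$ fix cut-off functions as follows. The function $\mu(\cdot;\varepsilon):[0,\infty)\to[0,1]$ is smooth, equals $1$ near $0$, vanishes for $t\ge\varepsilon$, and satisfies $0\le-\mu'(t;\varepsilon)\le\varepsilon/t$ for $t>0$. The function $\pi(\cdot;\mathfrak d):\mathbb R\to[0,1]$ is smooth, equals $0$ for $|t|\le\frac{5\mathfrak d}4$ and $1$ for $|t|\ge\frac{7\mathfrak d}4$, and satisfies $|\pi'(t;\mathfrak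 d)|\le 4/\mathfrak d$ and $|\pi''(t;\mathfrak d)|\le K/\mathfrak d^2$ with a constant $K$ independent of $\mathfrak d$. (Such families exist.) For $\Phi\in\mathbb R$, $\varepsilon>0$, $\mathfrak d>L$ let $G(x_1,x_2)=\Phi\,\mu(f_2(x_1)-x_2;\varepsilon)$ and define the flux carrier $\mathbf g=(g_1,g_2)$ on $\Omega$ by $$g_1=\partial_{x_2}G+\Big(\frac\Phi2-\partial_{x_2}G\Big)\pi(x_1;\mathfrak d),\qquad g_2=\begin{cases}-\partial_{x_1}G,&|x_1|<\mathfrak d,\\ \pi'(x_1;\mathfrak d)\big(G-\frac\Phi2(x_2+1)\big),&|x_1|\ge\mathfrak d.\end{cases}$$ Then, for the fixed channel $\Omega$ and the fixed families of cut-off functions, the following holds. (a) For all $\varepsilon>0$ and $\mathfrak d>L$ there is a constant $C(\varepsilon,\mathfrak d)$, independent of $\Phi$, such that for every $\Phi\in\mathbb R$ the function $|\nabla\mathbf g|^2+|\mathbf g\cdot\nabla\mathbf g|^2$ is integrable on $\Omega$ and $$\int_\Omega|\nabla\mathbf g|^2+|\mathbf g\cdot\nabla\mathbf g|^2\,dx\le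 C(\varepsilon,\mathfrak d)\,(\Phi^2+\Phi^4).$$ (b) For every $\Phi\in\mathbb R$ and $\delta>0$ one can choose $\varepsilon$ small and then $\mathfrak d$ large such that $$\Big|\int_\Omega\mathbf v\cdot\nabla\mathbf g\cdot\mathbf v\,dx\Big|\le\delta\,\|\nabla\mathbf v\|_{L^2(\Omega)}^2\qquad\text{for all }\mathbf v\in H_\sigma(\Omega).$$ More precisely, there is $\varepsilon_0>0$ such that for every $\varepsilon\in(0,\varepsilon_0]$ there is $\mathfrak d_0>L$ such that for every $\mathfrak d\ge\mathfrak d_0$ and every $\mathbf v\in H_\sigma(\Omega)$ the integrand $\mathbf v\cdot\nabla\mathbf g\cdot\mathbf v$ is integrable on $\Omega$ and the inequality holds. -/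

import Mathlib

open Set Filter Topology MeasureTheory
open scoped ContDiff

namespace SlipChannel

/-- A planar channel with straight outlets: it lies between the graphs of the smooth functions
`f₁ < f₂`, and `f₁ = -1`, `f₂ = 1` for `|t| ≥ L`. -/
structure Channel where
  f₁ : ℝ → ℝ
  f₂ : ℝ → ℝ
  L : ℝ
  L_pos : 0 < L
  smooth₁ : ContDiff ℝ ∞ f₁
  smooth₂ : ContDiff ℝ ∞ f₂
  lt : ∀ t, f₁ t < f₂ t
  straight₁ : ∀ t, L ≤ |t| → f₁ t = -1
  straight₂ : ∀ t, L ≤ |t| → f₂ t = 1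

/-- The open set `Ω = {(x₁, x₂) : f₁(x₁) < x₂ < f₂(x₁)}`. -/
def Channel.domain (Ω : Channel) : Set (ℝ × ℝ) :=
  {x | Ω.f₁ x.1 < x.2 ∧ x.2 < Ω.f₂ x.1}

/-- The two first order partial derivatives of a scalar function on the plane
(index `0` is `x₁`, index `1` is `x₂`). -/
noncomputable def partialD (j : Fin 2) (φ : ℝ × ℝ → ℝ) (x : ℝ × ℝ) : ℝ :=
  ![deriv (fun s => φ (s, x.2)) x.1, deriv (fun s => φ (x.1, s)) x.2] j

/-- The outer unit normal of `Ω` at the upper boundary point `(t, f₂ t)`. -/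
noncomputable def Channel.upperNormal (Ω : Channel) (t : ℝ) : Fin 2 → ℝ :=
  ![-deriv Ω.f₂ t / √(1 + deriv Ω.f₂ t ^ 2), 1 / √(1 + deriv Ω.f₂ t ^ 2)]

/-- The outer unit normal of `Ω` at the lower boundary point `(t, f₁ t)`. -/
noncomputable def Channel.lowerNormal (Ω : Channel) (t : ℝ) : Fin 2 → ℝ :=
  ![deriv Ω.f₁ t / √(1 + deriv Ω.f₁ t ^ 2), -1 / √(1 + deriv Ω.f₁ t ^ 2)]

/-- The smooth solenoidal vector fields of finite `H¹(Ω)` norm that are tangential at `∂Ω`;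
`u i` is the `i`-th component. Smooth up to the boundary means here: restriction to `Ω` of a
smooth field on the plane. -/
structure IsSmoothSolenoidal (Ω : Channel) (u : Fin 2 → ℝ × ℝ → ℝ) : Prop where
  smooth : ∀ i, ContDiff ℝ ∞ (u i)
  memLp : ∀ i, MemLp (u i) 2 (volume.restrict Ω.domain)
  memLp_grad : ∀ i j, MemLp (partialD j (u i)) 2 (volume.restrict Ω.domain)
  div_eq_zero : ∀ x ∈ Ω.domain, ∑ i, partialD i (u i) x = 0
  upper : ∀ t, ∑ i, u i (t, Ω.f₂ t) * Ω.upperNormal t i = 0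
  lower : ∀ t, ∑ i, u i (t, Ω.f₁ t) * Ω.lowerNormal t i = 0

/-- `A i j` is the weak partial derivative `∂ⱼ vᵢ` in `Ω`. -/
def IsWeakGradient (Ω : Channel) (v : Fin 2 → ℝ × ℝ → ℝ)
    (A : Fin 2 → Fin 2 → ℝ × ℝ → ℝ) : Prop :=
  ∀ φ : ℝ × ℝ → ℝ, ContDiff ℝ ∞ φ → HasCompactSupport φ → tsupport φ ⊆ Ω.domain →
    ∀ i j, ∫ x in Ω.domain, v i x * partialD j φ x = -∫ x in Ω.domain, A i j x * φ x

/-- `v ∈ H_σ(Ω)`, with weak gradient `A`: the field `v` lies in `H¹(Ω)` and is the limit, in the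
`H¹(Ω)` norm, of a sequence of smooth solenoidal fields tangential at the boundary. -/
structure MemHσ (Ω : Channel) (v : Fin 2 → ℝ × ℝ → ℝ)
    (A : Fin 2 → Fin 2 → ℝ × ℝ → ℝ) : Prop where
  memLp : ∀ i, MemLp (v i) 2 (volume.restrict Ω.domain)
  memLp_grad : ∀ i j, MemLp (A i j) 2 (volume.restrict Ω.domain)
  weakGradient : IsWeakGradient Ω v A
  approx : ∃ u : ℕ → Fin 2 → ℝ × ℝ → ℝ, (∀ n, IsSmoothSolenoidal Ω (u n)) ∧
    (∀ i, Tendsto (fun n => eLpNorm (u n i - v i) 2 (volume.restrict Ω.domain)) atTop (𝓝 0)) ∧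
    (∀ i j, Tendsto (fun n => eLpNorm (partialD j (u n i) - A i j) 2
      (volume.restrict Ω.domain)) atTop (𝓝 0))

/-- The cut-off functions `μ(t; ε)` and `π(t; d)` used in the construction, written `mu ε t` and
`pi d t`. The constant `K` does not depend on `d`. -/
structure CutoffFamily where
  mu : ℝ → ℝ → ℝ
  mu_smooth : ∀ ε, 0 < ε → ContDiffOn ℝ ∞ (mu ε) (Ici 0)
  mu_mem : ∀ ε, 0 < ε → ∀ t, 0 ≤ t → mu ε t ∈ Icc (0 : ℝ) 1
  mu_near_zero : ∀ ε, 0 < ε → ∃ η, 0 < η ∧ ∀ t ∈ Icc 0 η, mu ε t = 1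
  mu_eq_zero : ∀ ε, 0 < ε → ∀ t, ε ≤ t → mu ε t = 0
  mu_deriv : ∀ ε, 0 < ε → ∀ t, 0 < t → 0 ≤ -deriv (mu ε) t ∧ -deriv (mu ε) t ≤ ε / t
  pi : ℝ → ℝ → ℝ
  K : ℝ
  pi_smooth : ∀ d, 0 < d → ContDiff ℝ ∞ (pi d)
  pi_mem : ∀ d, 0 < d → ∀ t, pi d t ∈ Icc (0 : ℝ) 1
  pi_eq_zero : ∀ d, 0 < d → ∀ t, |t| ≤ 5 * d / 4 → pi d t = 0
  pi_eq_one : ∀ d, 0 < d → ∀ t, 7 * d / 4 ≤ |t| → pi d t = 1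
  pi_deriv : ∀ d, 0 < d → ∀ t, |deriv (pi d) t| ≤ 4 / d
  pi_deriv2 : ∀ d, 0 < d → ∀ t, |deriv (deriv (pi d)) t| ≤ K / d ^ 2

/-- A smooth monotone step from `0` to `1` on `[0, 1]` with slope at most `2`. -/
theorem exists_step : ∃ h : ℝ → ℝ, ContDiff ℝ ∞ h ∧ (∀ s, h s ∈ Icc (0 : ℝ) 1) ∧
    (∀ s, s ≤ 0 → h s = 0) ∧ (∀ s, 1 ≤ s → h s = 1) ∧ (∀ s, 0 ≤ deriv h s) ∧
    (∀ s, deriv h s ≤ 2) ∧ (∀ s, s ≤ 0 → deriv h s = 0) ∧ ∃ M, ∀ s, |deriv (deriv h) s| ≤ M := by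
  let b : ContDiffBump (1 / 2 : ℝ) := ⟨1 / 4, 1 / 2, by norm_num, by norm_num⟩
  have hbc : Continuous b := b.continuous
  have hb0 : ∀ s, s ≤ 0 → b s = 0 := fun s hs => b.zero_of_le_dist (by
    rw [Real.dist_eq, abs_of_nonpos (by linarith)]; show (1 / 2 : ℝ) ≤ _; linarith)
  have hb1 : ∀ s, 1 ≤ s → b s = 0 := fun s hs => b.zero_of_le_dist (by
    rw [Real.dist_eq, abs_of_nonneg (by linarith)]; show (1 / 2 : ℝ) ≤ _; linarith)
  have hii : ∀ p q : ℝ, IntervalIntegrable b volume p q := fun p q => hbc.intervalIntegrable p q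
  set I : ℝ := ∫ x in (0 : ℝ)..1, b x with hI
  have hsplit : I = (∫ x in (0 : ℝ)..(1 / 4), b x) + (∫ x in (1 / 4 : ℝ)..(3 / 4), b x) +
      ∫ x in (3 / 4 : ℝ)..1, b x := by
    rw [intervalIntegral.integral_add_adjacent_intervals (hii _ _) (hii _ _),
      intervalIntegral.integral_add_adjacent_intervals (hii _ _) (hii _ _)]
  have hmid : (∫ x in (1 / 4 : ℝ)..(3 / 4), b x) = 1 / 2 := by
    rw [intervalIntegral.integral_congr (g := fun _ => (1 : ℝ))]
    · norm_num
    · intro x hx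
      rw [uIcc_of_le (by norm_num)] at hx
      apply b.one_of_mem_closedBall
      rw [Metric.mem_closedBall, Real.dist_eq]
      show _ ≤ (1 / 4 : ℝ)
      rw [abs_le]; constructor <;> linarith [hx.1, hx.2]
  have hI2 : 1 / 2 ≤ I := by
    have h1 : 0 ≤ ∫ x in (0 : ℝ)..(1 / 4), b x :=
      intervalIntegral.integral_nonneg (by norm_num) fun x _ => b.nonneg
    have h2 : 0 ≤ ∫ x in (3 / 4 : ℝ)..1, b x :=
      intervalIntegral.integral_nonneg (by norm_num) fun x _ => b.nonneg
    linarith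
  have hI0 : 0 < I := by linarith
  let h : ℝ → ℝ := fun s => (∫ x in (0 : ℝ)..s, b x) / I
  have hd : ∀ s, HasDerivAt h (b s / I) s := fun s =>
    (intervalIntegral.integral_hasDerivAt_right (hii _ _)
      (hbc.stronglyMeasurableAtFilter _ _) hbc.continuousAt).div_const I
  have hd' : deriv h = fun s => b s / I := funext fun s => (hd s).deriv
  have hds : ContDiff ℝ ∞ (deriv h) := by rw [hd']; exact b.contDiff.div_const I
  have hz : ∀ s, s ≤ 0 → h s = 0 := fun s hs => by
    have : (∫ x in (0 : ℝ)..s, b x) = 0 := by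
      rw [intervalIntegral.integral_congr (g := fun _ => (0 : ℝ))]
      · simp
      · intro x hx
        rw [uIcc_of_ge hs] at hx
        exact hb0 x hx.2
    simp [h, this]
  have ho : ∀ s, 1 ≤ s → h s = 1 := fun s hs => by
    have h1 : (∫ x in (1 : ℝ)..s, b x) = 0 := by
      rw [intervalIntegral.integral_congr (g := fun _ => (0 : ℝ))]
      · simp
      · intro x hx
        rw [uIcc_of_le hs] at hx
        exact hb1 x hx.1
    have h2 := intervalIntegral.integral_add_adjacent_intervals (hii 0 1) (hii 1 s)
    show (∫ x in (0 : ℝ)..s, b x) / I = 1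
    rw [← h2, h1, add_zero, div_self hI0.ne']
  have hnn : ∀ s, 0 ≤ deriv h s := fun s => by
    rw [hd']; exact div_nonneg b.nonneg hI0.le
  have hdiff : Differentiable ℝ h := fun s => (hd s).differentiableAt
  have hmono : Monotone h := monotone_of_deriv_nonneg hdiff hnn
  refine ⟨h, contDiff_infty_iff_deriv.2 ⟨hdiff, hds⟩, ?_, hz, ho, hnn, ?_, ?_, ?_⟩
  · intro s
    constructor
    · rw [← hz (min s 0) (min_le_right _ _)]; exact hmono (min_le_left _ _)
    · rw [← ho (max s 1) (le_max_right _ _)]; exact hmono (le_max_left _ _)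
  · intro s
    rw [hd', div_le_iff₀ hI0]
    linarith [b.le_one (x := s)]
  · intro s hs
    rw [hd']; simp [hb0 s hs]
  · have hcs : HasCompactSupport (deriv h) := by
      rw [hd']
      exact b.hasCompactSupport.comp_left (g := fun y => y / I) (by simp)
    have hc2 : Continuous (deriv (deriv h)) := hds.continuous_deriv (by simp)
    obtain ⟨M, hM⟩ := hc2.bounded_above_of_compact_support hcs.deriv
    exact ⟨M, fun s => by simpa using hM s⟩

/-- Cut-off functions with the required properties exist. -/
instance : Nonempty CutoffFamily := by
  obtain ⟨h, hs, hm, h0, h1, hn, h2, hd0, M, hM⟩ := exists_step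
  have hdf : Differentiable ℝ h := hs.differentiable (by simp)
  have hs' : ContDiff ℝ ∞ (deriv h) := (contDiff_infty_iff_deriv.1 hs).2
  have hdf' : Differentiable ℝ (deriv h) := hs'.differentiable (by simp)
  let e : ℝ → ℝ := fun ε => ε * Real.exp (-(2 / ε))
  let m : ℝ → ℝ → ℝ := fun ε t => if t ≤ e ε then 1 else h (ε / 2 * Real.log (ε / t))
  have he : ∀ ε, 0 < ε → 0 < e ε := fun ε hε => mul_pos hε (Real.exp_pos _)
  have hmpos : ∀ ε, 0 < ε → ∀ t, 0 < t → m ε t = h (ε / 2 * Real.log (ε / t)) := by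
    intro ε hε t ht
    by_cases hte : t ≤ e ε
    · simp only [m, hte, if_true]
      symm
      apply h1
      have : 2 / ε ≤ Real.log (ε / t) := by
        rw [Real.le_log_iff_exp_le (by positivity), le_div_iff₀ ht]
        calc Real.exp (2 / ε) * t ≤ Real.exp (2 / ε) * (ε * Real.exp (-(2 / ε))) := by
              gcongr
          _ = ε := by
              rw [Real.exp_neg]; field_simp
      calc (1 : ℝ) = ε / 2 * (2 / ε) := by field_simp
        _ ≤ _ := by gcongr
    · simp [m, hte]
  have hev : ∀ ε, 0 < ε → ∀ t, 0 < t →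
      m ε =ᶠ[𝓝 t] fun t => h (ε / 2 * Real.log (ε / t)) := fun ε hε t ht => by
    filter_upwards [lt_mem_nhds ht] with s hs using hmpos ε hε s hs
  have hmd : ∀ ε, 0 < ε → ∀ t, 0 < t →
      deriv (m ε) t = -(deriv h (ε / 2 * Real.log (ε / t)) * (ε / 2 / t)) := by
    intro ε hε t ht
    rw [(hev ε hε t ht).deriv_eq]
    have a1 : HasDerivAt (fun t => ε / 2 * Real.log (ε / t)) (-(ε / 2 / t)) t := by
      have a0 : HasDerivAt (fun t => ε / t) (-ε / t ^ 2) t := by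
        simpa [div_eq_mul_inv] using (hasDerivAt_inv ht.ne').const_mul ε
      refine ((a0.log (div_pos hε ht).ne').const_mul (ε / 2)).congr_deriv ?_
      field_simp
    have := (hdf (ε / 2 * Real.log (ε / t))).hasDerivAt.comp t a1
    simpa [Function.comp_def] using this.deriv
  let p : ℝ → ℝ → ℝ := fun d t =>
    h ((t - 5 * d / 4) * (2 / d)) + h ((-t - 5 * d / 4) * (2 / d))
  have hpd : ∀ d, deriv (p d) = fun t => deriv h ((t - 5 * d / 4) * (2 / d)) * (2 / d) -
      deriv h ((-t - 5 * d / 4) * (2 / d)) * (2 / d) := by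
    intro d; funext t
    have a1 : HasDerivAt (fun t => (t - 5 * d / 4) * (2 / d)) (1 * (2 / d)) t :=
      ((hasDerivAt_id t).sub_const _).mul_const _
    have a2 : HasDerivAt (fun t => (-t - 5 * d / 4) * (2 / d)) (-1 * (2 / d)) t :=
      ((hasDerivAt_id t).neg.sub_const _).mul_const _
    have a3 : HasDerivAt (p d) _ t :=
      ((hdf _).hasDerivAt.comp t a1).add ((hdf _).hasDerivAt.comp t a2)
    rw [a3.deriv]
    ring
  have hpd2 : ∀ d, deriv (deriv (p d)) = fun t =>
      deriv (deriv h) ((t - 5 * d / 4) * (2 / d)) * (2 / d) ^ 2 +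
      deriv (deriv h) ((-t - 5 * d / 4) * (2 / d)) * (2 / d) ^ 2 := by
    intro d; funext t
    rw [hpd]
    have a1 : HasDerivAt (fun t => (t - 5 * d / 4) * (2 / d)) (1 * (2 / d)) t :=
      ((hasDerivAt_id t).sub_const _).mul_const _
    have a2 : HasDerivAt (fun t => (-t - 5 * d / 4) * (2 / d)) (-1 * (2 / d)) t :=
      ((hasDerivAt_id t).neg.sub_const _).mul_const _
    have a3 : HasDerivAt (fun t => deriv h ((t - 5 * d / 4) * (2 / d)) * (2 / d) -
        deriv h ((-t - 5 * d / 4) * (2 / d)) * (2 / d)) _ t :=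
      (((hdf' _).hasDerivAt.comp t a1).mul_const (2 / d)).sub
        (((hdf' _).hasDerivAt.comp t a2).mul_const (2 / d))
    rw [a3.deriv]
    ring
  have hneg : ∀ d : ℝ, 0 < d → ∀ t : ℝ, t ≤ 5 * d / 4 → (t - 5 * d / 4) * (2 / d) ≤ 0 :=
    fun d hd t ht => mul_nonpos_of_nonpos_of_nonneg (by linarith) (by positivity)
  have hone : ∀ d : ℝ, 0 < d → ∀ t : ℝ, 7 * d / 4 ≤ t → 1 ≤ (t - 5 * d / 4) * (2 / d) :=
    fun d hd t ht => by
      calc (1 : ℝ) = (7 * d / 4 - 5 * d / 4) * (2 / d) := by field_simp; norm_num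
        _ ≤ _ := by gcongr
  refine ⟨⟨m, ?_, ?_, ?_, ?_, ?_, p, 8 * M, ?_, ?_, ?_, ?_, ?_, ?_⟩⟩
  · intro ε hε t ht
    apply ContDiffAt.contDiffWithinAt
    rcases eq_or_lt_of_le (show (0 : ℝ) ≤ t from ht) with rfl | ht
    · have : m ε =ᶠ[𝓝 0] fun _ => (1 : ℝ) := by
        filter_upwards [gt_mem_nhds (he ε hε)] with s hs
        simp [m, hs.le]
      exact contDiffAt_const.congr_of_eventuallyEq this
    · refine ContDiffAt.congr_of_eventuallyEq ?_ (hev ε hε t ht)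
      refine hs.contDiffAt.comp t ?_
      exact contDiffAt_const.mul ((contDiffAt_const.div contDiffAt_id ht.ne').log
        (by simp; exact ⟨hε.ne', ht.ne'⟩))
  · intro ε hε t _
    by_cases hte : t ≤ e ε
    · simp [m, hte]
    · simp only [m, hte, if_false]; exact hm _
  · intro ε hε
    exact ⟨e ε, he ε hε, fun t ht => by simp [m, ht.2]⟩
  · intro ε hε t ht
    have ht0 : 0 < t := hε.trans_le ht
    rw [hmpos ε hε t ht0]
    apply h0
    exact mul_nonpos_of_nonneg_of_nonpos (by positivity)
      (Real.log_nonpos (by positivity) ((div_le_one ht0).2 ht))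
  · intro ε hε t ht
    rw [hmd ε hε t ht, neg_neg]
    refine ⟨mul_nonneg (hn _) (by positivity), ?_⟩
    calc _ ≤ 2 * (ε / 2 / t) := by gcongr; exact h2 _
      _ = ε / t := by ring
  · intro d _
    exact (hs.comp ((contDiff_id.sub contDiff_const).mul contDiff_const)).add
      (hs.comp ((contDiff_neg.sub contDiff_const).mul contDiff_const))
  · intro d hd t
    rcases le_total t 0 with ht | ht
    · simp only [p, h0 _ (hneg d hd t (by linarith)), zero_add]; exact hm _
    · simp only [p, h0 _ (hneg d hd (-t) (by linarith)), add_zero]; exact hm _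
  · intro d hd t ht
    rw [abs_le] at ht
    simp only [p, h0 _ (hneg d hd t ht.2), h0 _ (hneg d hd (-t) (by linarith [ht.1])), add_zero]
  · intro d hd t ht
    rcases le_total t 0 with h3 | h3
    · rw [abs_of_nonpos h3] at ht
      simp only [p, h0 _ (hneg d hd t (by linarith)), h1 _ (hone d hd (-t) ht), zero_add]
    · rw [abs_of_nonneg h3] at ht
      simp only [p, h0 _ (hneg d hd (-t) (by linarith)), h1 _ (hone d hd t ht), add_zero]
  · intro d hd t
    have key : ∀ s, |deriv h s * (2 / d)| ≤ 4 / d := fun s => by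
      rw [abs_of_nonneg (mul_nonneg (hn s) (by positivity))]
      calc _ ≤ 2 * (2 / d) := by gcongr; exact h2 _
        _ = 4 / d := by ring
    rw [hpd]
    rcases le_total t 0 with h3 | h3
    · simp only [hd0 _ (hneg d hd t (by linarith)), zero_mul, zero_sub, abs_neg]; exact key _
    · simp only [hd0 _ (hneg d hd (-t) (by linarith)), zero_mul, sub_zero]; exact key _
  · intro d hd t
    rw [hpd2]
    have key : ∀ s, |deriv (deriv h) s * (2 / d) ^ 2| ≤ 4 * M / d ^ 2 := fun s => by
      rw [abs_mul, abs_of_nonneg (sq_nonneg (2 / d))]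
      calc _ ≤ M * (2 / d) ^ 2 := by gcongr; exact hM s
        _ = 4 * M / d ^ 2 := by ring
    calc _ ≤ _ := abs_add_le _ _
      _ ≤ 4 * M / d ^ 2 + 4 * M / d ^ 2 := add_le_add (key _) (key _)
      _ = 8 * M / d ^ 2 := by ring

/-- `G(x₁, x₂; ε) = Φ μ(f₂(x₁) - x₂; ε)`. -/
noncomputable def potential (Ω : Channel) (c : CutoffFamily) (Φ ε : ℝ) (x : ℝ × ℝ) : ℝ :=
  Φ * c.mu ε (Ω.f₂ x.1 - x.2)

/-- The flux carrier `g = (g₁, g₂)`. -/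
noncomputable def carrier (Ω : Channel) (c : CutoffFamily) (Φ ε d : ℝ) :
    Fin 2 → ℝ × ℝ → ℝ :=
  ![fun x => partialD 1 (potential Ω c Φ ε) x +
      (Φ / 2 - partialD 1 (potential Ω c Φ ε) x) * c.pi d x.1,
    fun x => if |x.1| < d then -partialD 0 (potential Ω c Φ ε) x
      else deriv (c.pi d) x.1 * (potential Ω c Φ ε x - Φ / 2 * (x.2 + 1))]

/-- `|∇g|²`, the sum of the squares of all first order partial derivatives. -/
noncomputable def gradSq (g : Fin 2 → ℝ × ℝ → ℝ) (x : ℝ × ℝ) : ℝ :=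
  ∑ i, ∑ j, partialD j (g i) x ^ 2

/-- `|g · ∇g|²`, where `(g · ∇g)ᵢ = ∑ⱼ gⱼ ∂ⱼ gᵢ`. -/
noncomputable def convectionSq (g : Fin 2 → ℝ × ℝ → ℝ) (x : ℝ × ℝ) : ℝ :=
  ∑ i, (∑ j, g j x * partialD j (g i) x) ^ 2

/-- `v · ∇g · v = ∑ᵢⱼ vⱼ (∂ⱼ gᵢ) vᵢ`. -/
noncomputable def trilinear (v g : Fin 2 → ℝ × ℝ → ℝ) (x : ℝ × ℝ) : ℝ :=
  ∑ i, ∑ j, v j x * partialD j (g i) x * v i x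

end SlipChannel

open SlipChannel

namespace SlipChannel

/-! On `Ω` the carrier is `Φ` times one field `h` that is smooth on the whole plane (`unitCarrier`).
The two branches in the definition of its second component agree with a single formula, since at
every abscissa either the horizontal cut-off is inactive or the upper wall is flat. For large `|x₁|`
the field `h` is constant, so its gradient lives on a bounded piece of the channel. Part (a) is then
homogeneity: `|∇g|²` is quadratic in `Φ`, and `|g · ∇g|²` is quartic.

For part (b), write `s = f₂(x₁) - x₂`, `β = f₂'`, `k = (1 - π) μ'(s)`, `w = u₂ - β u₁` and `q = u₁ +
β u₂`. Near the wall `h` is essentially `-k (1, β)`, and `u · ∇h · u` contains `μ''(s) w q`, for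
which no bound in terms of `ε` is available. One integration by parts in `x₂` replaces `μ''` by `μ'`
and leaves `k w ∂₂q + k q ∂₂w`. Only `w` vanishes on the wall, because the slip condition leaves `q`
free, so `k q ∂₂w` needs another argument. Since `div u = 0`, `∂₂w = -(∂₁ + β ∂₂) u₁`, and `∂₁ + β
∂₂` annihilates `s`. As `q = (1 + β²) u₁ + β w`, the bad term is a derivative of `k (1 + β²) u₁² /
2` along the wall plus terms with a factor `w` or a derivative of `π`. This is the pointwise
identity `trilinear_unitCarrier_eq`: the form equals a divergence plus `wallPart` plus `cutoffPart`.
The divergence integrates to zero, because its field is compactly supported in `Ω` once `ε` is below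
the width of the channel.

In `wallPart` the factor `k w` is `O(ε) |w| / (s + η)`, where the profile is constant for `s < η`,
and Hardy's inequality on vertical sections gives `O(ε) ‖∇u‖²`. In `cutoffPart` every term carries
`π'` or `π''`, hence `1/d`, and Poincaré's inequality gives `C(ε) ‖∇u‖² / d`; this is why `d` is
chosen after `ε`. Poincaré's inequality holds because `w` vanishes on the upper wall and `u₁` has
mean zero on each section: the flux is constant in `x₁` and square integrable on the line. The
resulting bound passes from smooth fields to `H_σ` by `L²` convergence, as `∇h` is bounded. -/

/-! ### One-dimensional inequalities -/

/-- Hardy's inequality on `[a, b]` for a function vanishing at `b`, with a regularised weight. -/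
theorem hardy_interval {z z' : ℝ → ℝ} (hz : ∀ y, HasDerivAt z (z' y) y) (hz' : Continuous z')
    {a b κ : ℝ} (hab : a ≤ b) (hκ : 0 < κ) (hb : z b = 0) :
    ∫ y in a..b, z y ^ 2 / (b - y + κ) ^ 2 ≤ 4 * ∫ y in a..b, z' y ^ 2 := by
  have hzc : Continuous z := continuous_iff_continuousAt.2 fun y => (hz y).continuousAt
  have hρ : ∀ y ∈ Icc a b, 0 < b - y + κ := fun y hy => by linarith [hy.2]
  have hne : ∀ y ∈ uIcc a b, b - y + κ ≠ 0 := fun y hy => by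
    rw [uIcc_of_le hab] at hy; exact (hρ y hy).ne'
  let θ' : ℝ → ℝ := fun y => (2 * z y * z' y * (b - y + κ) + z y ^ 2) / (b - y + κ) ^ 2
  have hder : ∀ y ∈ uIcc a b, HasDerivAt (fun y => z y ^ 2 / (b - y + κ)) (θ' y) y := by
    intro y hy
    have h1 : HasDerivAt (fun y => b - y + κ) (-1) y := by
      simpa using ((hasDerivAt_id y).const_sub b).add_const κ
    refine (((hz y).pow 2).div h1 (hne y hy)).congr_deriv ?_
    simp only [θ']
    congr 1
    simp
  have cθ : ContinuousOn θ' (uIcc a b) := by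
    apply ContinuousOn.div
    · fun_prop
    · fun_prop
    · intro y hy; exact pow_ne_zero 2 (hne y hy)
  have cw : ContinuousOn (fun y => z y ^ 2 / (b - y + κ) ^ 2) (uIcc a b) := by
    apply ContinuousOn.div
    · fun_prop
    · fun_prop
    · intro y hy; exact pow_ne_zero 2 (hne y hy)
  have hFTC := intervalIntegral.integral_eq_sub_of_hasDerivAt hder cθ.intervalIntegrable
  have hle : ∫ y in a..b, z y ^ 2 / (b - y + κ) ^ 2 ≤ ∫ y in a..b, (4 * z' y ^ 2 + 2 * θ' y) := by
    apply intervalIntegral.integral_mono_on hab cw.intervalIntegrable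
    · apply ContinuousOn.intervalIntegrable
      exact (by fun_prop : Continuous fun y => 4 * z' y ^ 2).continuousOn.add
        (continuousOn_const.mul cθ)
    -- The integrand inequality is a completed square: with `ρ = b - y + κ` and `θ = z² / ρ`, the
    -- difference is `(2z' + z/ρ)²`. The boundary term of `θ` has a favourable sign because `z b =
    -- 0`.
    · intro y hy
      have hr := hρ y hy
      have : 4 * z' y ^ 2 + 2 * θ' y - z y ^ 2 / (b - y + κ) ^ 2 =
          (2 * z' y + z y / (b - y + κ)) ^ 2 := by
        simp only [θ']; field_simp; ring
      nlinarith [sq_nonneg (2 * z' y + z y / (b - y + κ))]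
  rw [intervalIntegral.integral_add, intervalIntegral.integral_const_mul,
    intervalIntegral.integral_const_mul, hFTC, hb] at hle
  · have : 0 ≤ z a ^ 2 / (b - a + κ) := div_nonneg (sq_nonneg _) (hρ a ⟨le_rfl, hab⟩).le
    simp only [ne_eq, OfNat.ofNat_ne_zero, not_false_eq_true, zero_pow, zero_div] at hle
    linarith
  · exact (by fun_prop : Continuous fun y => 4 * z' y ^ 2).intervalIntegrable _ _
  · exact (continuousOn_const.mul cθ).intervalIntegrable

/-- Poincaré's inequality on `[a, b]` for a function vanishing at `b`. -/
theorem poincare_interval_of_end {z z' : ℝ → ℝ} (hz : ∀ y, HasDerivAt z (z' y) y)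
    (hz' : Continuous z') {a b M : ℝ} (hab : a ≤ b) (hM : b - a ≤ M) (hb : z b = 0) :
    ∫ y in a..b, z y ^ 2 ≤ 4 * (M + 1) ^ 2 * ∫ y in a..b, z' y ^ 2 := by
  have hzc : Continuous z := continuous_iff_continuousAt.2 fun y => (hz y).continuousAt
  -- With `κ = 1` the Hardy weight is at least `1 / (M + 1)²` on the interval.
  have h := hardy_interval hz hz' hab one_pos hb
  have hle : ∫ y in a..b, z y ^ 2 ≤ ∫ y in a..b, (M + 1) ^ 2 * (z y ^ 2 / (b - y + 1) ^ 2) := by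
    apply intervalIntegral.integral_mono_on hab
    · exact (by fun_prop : Continuous fun y => z y ^ 2).intervalIntegrable _ _
    · apply ContinuousOn.intervalIntegrable
      refine continuousOn_const.mul (ContinuousOn.div (by fun_prop) (by fun_prop) ?_)
      intro y hy
      rw [uIcc_of_le hab] at hy
      have : 0 < b - y + 1 := by linarith [hy.2]
      positivity
    · intro y hy
      have h1 : 0 < b - y + 1 := by linarith [hy.2]
      have h2 : b - y + 1 ≤ M + 1 := by linarith [hy.1]
      rw [← mul_div_assoc, le_div_iff₀ (by positivity), mul_comm]
      gcongr
  rw [intervalIntegral.integral_const_mul] at hle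
  nlinarith [sq_nonneg (M + 1)]

/-- Poincaré's inequality on `[a, b]` for a function of mean zero. -/
theorem poincare_interval_of_mean {z z' : ℝ → ℝ} (hz : ∀ y, HasDerivAt z (z' y) y)
    (hz' : Continuous z') {a b M : ℝ} (hab : a ≤ b) (hM : b - a ≤ M)
    (hmean : ∫ y in a..b, z y = 0) :
    ∫ y in a..b, z y ^ 2 ≤ 4 * (M + 1) ^ 2 * ∫ y in a..b, z' y ^ 2 := by
  have hzc : Continuous z := continuous_iff_continuousAt.2 fun y => (hz y).continuousAt
  -- Mean zero makes this primitive vanish at both ends, so `∫ z² = -∫ z' ζ` without boundary terms,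
  -- and `ζ` obeys the previous inequality.
  let ζ : ℝ → ℝ := fun y => ∫ x in a..y, z x
  have hζ : ∀ y, HasDerivAt ζ (z y) y := fun y =>
    intervalIntegral.integral_hasDerivAt_right (hzc.intervalIntegrable _ _)
      (hzc.stronglyMeasurableAtFilter _ _) hzc.continuousAt
  have hζc : Continuous ζ := continuous_iff_continuousAt.2 fun y => (hζ y).continuousAt
  have h1 := poincare_interval_of_end hζ hzc hab hM hmean
  set Λ : ℝ := 4 * (M + 1) ^ 2 with hΛ
  have hΛ0 : 0 < Λ := by have : 0 < M + 1 := by linarith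
                         positivity
  have hparts := intervalIntegral.integral_mul_deriv_eq_deriv_mul (a := a) (b := b)
    (u := z) (v := ζ) (u' := z') (v' := z) (fun y _ => hz y) (fun y _ => hζ y)
    (hz'.intervalIntegrable _ _) (hzc.intervalIntegrable _ _)
  have hζa : ζ a = 0 := by simp [ζ]
  have hζb : ζ b = 0 := hmean
  rw [hζa, hζb] at hparts
  -- Young's inequality weighted so that, after `∫ ζ² ≤ Λ ∫ z²`, exactly half of `∫ z²` is absorbed
  -- on the left.
  have hle : -∫ y in a..b, z' y * ζ y ≤
      ∫ y in a..b, (1 / (2 * Λ) * ζ y ^ 2 + Λ / 2 * z' y ^ 2) := by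
    rw [← intervalIntegral.integral_neg]
    apply intervalIntegral.integral_mono_on hab
    · exact (by fun_prop : Continuous fun y => -(z' y * ζ y)).intervalIntegrable _ _
    · exact (by fun_prop : Continuous fun y =>
        1 / (2 * Λ) * ζ y ^ 2 + Λ / 2 * z' y ^ 2).intervalIntegrable _ _
    · intro y _
      have : 1 / (2 * Λ) * ζ y ^ 2 + Λ / 2 * z' y ^ 2 + z' y * ζ y =
          1 / (2 * Λ) * (ζ y + Λ * z' y) ^ 2 := by field_simp; ring
      have h3 : 0 ≤ 1 / (2 * Λ) * (ζ y + Λ * z' y) ^ 2 := by positivity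
      linarith
  rw [intervalIntegral.integral_add, intervalIntegral.integral_const_mul,
    intervalIntegral.integral_const_mul] at hle
  · have e1 : ∫ y in a..b, z y * z y = ∫ y in a..b, z y ^ 2 := by simp_rw [sq]
    rw [e1] at hparts
    have h4 : 1 / (2 * Λ) * ∫ y in a..b, ζ y ^ 2 ≤ 1 / (2 * Λ) * (Λ * ∫ y in a..b, z y ^ 2) := by
      gcongr
    have h5 : 1 / (2 * Λ) * (Λ * ∫ y in a..b, z y ^ 2) = (∫ y in a..b, z y ^ 2) / 2 := by
      field_simp
    linarith
  · exact (by fun_prop : Continuous fun y => 1 / (2 * Λ) * ζ y ^ 2).intervalIntegrable _ _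
  · exact (by fun_prop : Continuous fun y => Λ / 2 * z' y ^ 2).intervalIntegrable _ _

/-- The square of an integral over an interval of length at most `M`. -/
theorem sq_integral_le {z : ℝ → ℝ} (hz : Continuous z) {a b M : ℝ} (hab : a ≤ b)
    (hM : b - a ≤ M) (hM0 : 0 < M) :
    (∫ y in a..b, z y) ^ 2 ≤ M * ∫ y in a..b, z y ^ 2 := by
  set J := ∫ y in a..b, z y with hJ
  -- Integrates `0 ≤ (J/M - z)²`; the constant `J/M` is the optimal one for an interval of length
  -- `M`.
  have hle : ∫ y in a..b, 2 * (J / M) * z y ≤ ∫ y in a..b, ((J / M) ^ 2 + z y ^ 2) := by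
    apply intervalIntegral.integral_mono_on hab
    · exact (by fun_prop : Continuous fun y => 2 * (J / M) * z y).intervalIntegrable _ _
    · exact (by fun_prop : Continuous fun y => (J / M) ^ 2 + z y ^ 2).intervalIntegrable _ _
    · intro y _; nlinarith [sq_nonneg (J / M - z y)]
  rw [intervalIntegral.integral_add (by simp)
    ((by fun_prop : Continuous fun y => z y ^ 2).intervalIntegrable _ _),
    intervalIntegral.integral_const_mul, ← hJ, intervalIntegral.integral_const] at hle
  have h1 : (b - a) • (J / M) ^ 2 ≤ M * (J / M) ^ 2 := by
    rw [smul_eq_mul]; gcongr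
  have h2 : M * (J / M) ^ 2 = J ^ 2 / M := by field_simp
  have h3 : 2 * (J / M) * J = 2 * (J ^ 2 / M) := by ring
  have h4 : J ^ 2 / M ≤ ∫ y in a..b, z y ^ 2 := by linarith
  rw [div_le_iff₀ hM0] at h4
  linarith

/-- Differentiation under the integral sign over a compact interval, for jointly continuous
data. -/
theorem hasDerivAt_intervalIntegral_param {k k' : ℝ → ℝ → ℝ} (hk : Continuous k.uncurry)
    (hk' : Continuous k'.uncurry) (hd : ∀ t y, HasDerivAt (fun t => k t y) (k' t y) t)
    (a b t : ℝ) : HasDerivAt (fun t => ∫ y in a..b, k t y) (∫ y in a..b, k' t y) t := by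
  have hk1 : ∀ t, Continuous (k t) := fun t => hk.comp (by fun_prop : Continuous fun y => (t, y))
  have hk1' : ∀ t, Continuous (k' t) :=
    fun t => hk'.comp (by fun_prop : Continuous fun y => (t, y))
  obtain ⟨C, hC⟩ := ((isCompact_closedBall t 1).prod (isCompact_uIcc (a := a) (b := b))).exists_bound_of_continuousOn
    hk'.continuousOn
  refine (intervalIntegral.hasDerivAt_integral_of_dominated_loc_of_deriv_le
    (bound := fun _ => C) (Metric.ball_mem_nhds t one_pos) ?_ ?_ ?_ ?_ ?_ ?_).2
  · exact Eventually.of_forall fun s => (hk1 s).aestronglyMeasurable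
  · exact (hk1 t).intervalIntegrable _ _
  · exact (hk1' t).aestronglyMeasurable
  · exact Eventually.of_forall fun y hy s hs =>
      hC (s, y) ⟨Metric.ball_subset_closedBall hs, uIoc_subset_uIcc hy⟩
  · simp
  · exact Eventually.of_forall fun y _ s _ => hd s y

/-! ### Partial derivatives -/

theorem hasDerivAt_fst {φ : ℝ × ℝ → ℝ} (hφ : Differentiable ℝ φ) (x : ℝ × ℝ) :
    HasDerivAt (fun s => φ (s, x.2)) (fderiv ℝ φ x (1, 0)) x.1 := by
  have h : HasDerivAt (fun s : ℝ => (s, x.2)) ((1 : ℝ), (0 : ℝ)) x.1 :=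
    (hasDerivAt_id _).prodMk (hasDerivAt_const _ _)
  exact (hφ x).hasFDerivAt.comp_hasDerivAt x.1 h

theorem hasDerivAt_snd {φ : ℝ × ℝ → ℝ} (hφ : Differentiable ℝ φ) (x : ℝ × ℝ) :
    HasDerivAt (fun s => φ (x.1, s)) (fderiv ℝ φ x (0, 1)) x.2 := by
  have h : HasDerivAt (fun s : ℝ => (x.1, s)) ((0 : ℝ), (1 : ℝ)) x.2 :=
    (hasDerivAt_const _ _).prodMk (hasDerivAt_id _)
  exact (hφ x).hasFDerivAt.comp_hasDerivAt x.2 h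

theorem partialD_zero_eq {φ : ℝ × ℝ → ℝ} (hφ : Differentiable ℝ φ) (x : ℝ × ℝ) :
    partialD 0 φ x = fderiv ℝ φ x (1, 0) := (hasDerivAt_fst hφ x).deriv

theorem partialD_one_eq {φ : ℝ × ℝ → ℝ} (hφ : Differentiable ℝ φ) (x : ℝ × ℝ) :
    partialD 1 φ x = fderiv ℝ φ x (0, 1) := (hasDerivAt_snd hφ x).deriv

theorem hasDerivAt_partialD_zero {φ : ℝ × ℝ → ℝ} (hφ : Differentiable ℝ φ) (t y : ℝ) :
    HasDerivAt (fun s => φ (s, y)) (partialD 0 φ (t, y)) t := by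
  rw [partialD_zero_eq hφ]; exact hasDerivAt_fst hφ (t, y)

theorem hasDerivAt_partialD_one {φ : ℝ × ℝ → ℝ} (hφ : Differentiable ℝ φ) (t y : ℝ) :
    HasDerivAt (fun s => φ (t, s)) (partialD 1 φ (t, y)) y := by
  rw [partialD_one_eq hφ]; exact hasDerivAt_snd hφ (t, y)

theorem continuous_partialD {φ : ℝ × ℝ → ℝ} (hφ : ContDiff ℝ ∞ φ) (j : Fin 2) :
    Continuous (partialD j φ) := by
  have hd : Differentiable ℝ φ := hφ.differentiable (by simp)
  have hf : Continuous (fderiv ℝ φ) := hφ.continuous_fderiv (by simp)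
  fin_cases j
  · exact (hf.clm_apply continuous_const).congr fun x => (partialD_zero_eq hd x).symm
  · exact (hf.clm_apply continuous_const).congr fun x => (partialD_one_eq hd x).symm

theorem partialD_congr {φ ψ : ℝ × ℝ → ℝ} {x : ℝ × ℝ} (h : φ =ᶠ[𝓝 x] ψ) (j : Fin 2) :
    partialD j φ x = partialD j ψ x := by
  have h0 : Tendsto (fun s : ℝ => (s, x.2)) (𝓝 x.1) (𝓝 x) :=
    (by fun_prop : Continuous fun s : ℝ => (s, x.2)).tendsto x.1
  have h1 : Tendsto (fun s : ℝ => (x.1, s)) (𝓝 x.2) (𝓝 x) :=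
    (by fun_prop : Continuous fun s : ℝ => (x.1, s)).tendsto x.2
  fin_cases j
  · exact Filter.EventuallyEq.deriv_eq (h0.eventually h)
  · exact Filter.EventuallyEq.deriv_eq (h1.eventually h)

theorem partialD_const_mul (a : ℝ) (φ : ℝ × ℝ → ℝ) (j : Fin 2) (x : ℝ × ℝ) :
    partialD j (fun x => a * φ x) x = a * partialD j φ x := by
  fin_cases j <;> simp [partialD]

end SlipChannel

namespace SlipChannel

/-! ### Geometry of the channel -/

theorem exists_bound_of_const_outside {f : ℝ → ℝ} (hf : Continuous f) {L k : ℝ}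
    (h : ∀ t, L < |t| → f t = k) : ∃ B, 0 < B ∧ ∀ t, |f t| ≤ B := by
  obtain ⟨C, hC⟩ := (isCompact_Icc (a := -L) (b := L)).exists_bound_of_continuousOn hf.continuousOn
  refine ⟨max C |k| + 1, by positivity, fun t => ?_⟩
  rcases le_or_gt |t| L with ht | ht
  · have := hC t (abs_le.1 ht)
    rw [Real.norm_eq_abs] at this
    linarith [le_max_left C |k|]
  · rw [h t ht]; linarith [le_max_right C |k|]

theorem deriv_eq_zero_of_const_outside {f : ℝ → ℝ} {L k : ℝ} (h : ∀ t, L < |t| → f t = k)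
    {t : ℝ} (ht : L < |t|) : deriv f t = 0 := by
  have : f =ᶠ[𝓝 t] fun _ => k := by
    filter_upwards [(isOpen_lt continuous_const continuous_abs).mem_nhds ht] with s hs
      using h s hs
  rw [this.deriv_eq, deriv_const]

namespace Channel

variable (Ω : Channel)

theorem isOpen_domain : IsOpen Ω.domain :=
  (isOpen_lt (Ω.smooth₁.continuous.comp continuous_fst) continuous_snd).inter
    (isOpen_lt continuous_snd (Ω.smooth₂.continuous.comp continuous_fst))

theorem measurableSet_domain : MeasurableSet Ω.domain := Ω.isOpen_domain.measurableSet

theorem smooth_deriv₁ : ContDiff ℝ ∞ (deriv Ω.f₁) := (contDiff_infty_iff_deriv.1 Ω.smooth₁).2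

theorem smooth_deriv₂ : ContDiff ℝ ∞ (deriv Ω.f₂) := (contDiff_infty_iff_deriv.1 Ω.smooth₂).2

theorem smooth_deriv_deriv₂ : ContDiff ℝ ∞ (deriv (deriv Ω.f₂)) :=
  (contDiff_infty_iff_deriv.1 Ω.smooth_deriv₂).2

theorem hasDerivAt₁ (t : ℝ) : HasDerivAt Ω.f₁ (deriv Ω.f₁ t) t :=
  (Ω.smooth₁.differentiable (by simp) t).hasDerivAt

theorem hasDerivAt₂ (t : ℝ) : HasDerivAt Ω.f₂ (deriv Ω.f₂ t) t :=
  (Ω.smooth₂.differentiable (by simp) t).hasDerivAt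

theorem hasDerivAt_deriv₂ (t : ℝ) : HasDerivAt (deriv Ω.f₂) (deriv (deriv Ω.f₂) t) t :=
  (Ω.smooth_deriv₂.differentiable (by simp) t).hasDerivAt

theorem deriv₂_eq_zero {t : ℝ} (ht : Ω.L < |t|) : deriv Ω.f₂ t = 0 :=
  deriv_eq_zero_of_const_outside (fun s hs => Ω.straight₂ s hs.le) ht

theorem deriv_deriv₂_eq_zero {t : ℝ} (ht : Ω.L < |t|) : deriv (deriv Ω.f₂) t = 0 :=
  deriv_eq_zero_of_const_outside (fun _ hs => Ω.deriv₂_eq_zero hs) ht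

/-- Uniform bounds for the walls of a channel. -/
theorem exists_bounds : ∃ M, 1 ≤ M ∧ ∀ t, |Ω.f₁ t| ≤ M ∧ |Ω.f₂ t| ≤ M ∧
    Ω.f₂ t - Ω.f₁ t ≤ M ∧ |deriv Ω.f₂ t| ≤ M ∧ |deriv (deriv Ω.f₂) t| ≤ M := by
  obtain ⟨A, hA, h1⟩ := exists_bound_of_const_outside Ω.smooth₁.continuous
    fun t ht => Ω.straight₁ t ht.le
  obtain ⟨B, hB, h2⟩ := exists_bound_of_const_outside Ω.smooth₂.continuous
    fun t ht => Ω.straight₂ t ht.le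
  obtain ⟨C, hC, h3⟩ := exists_bound_of_const_outside Ω.smooth_deriv₂.continuous
    fun t ht => Ω.deriv₂_eq_zero ht
  obtain ⟨D, hD, h4⟩ := exists_bound_of_const_outside Ω.smooth_deriv_deriv₂.continuous
    fun t ht => Ω.deriv_deriv₂_eq_zero ht
  refine ⟨A + B + C + D + 1, by linarith, fun t => ⟨?_, ?_, ?_, ?_, ?_⟩⟩
  · linarith [h1 t]
  · linarith [h2 t]
  · linarith [(abs_le.1 (h1 t)).1, (abs_le.1 (h2 t)).2]
  · linarith [h3 t]
  · linarith [h4 t]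

/-- The width of a channel is bounded below. -/
theorem exists_width_lower_bound : ∃ m, 0 < m ∧ ∀ t, m ≤ Ω.f₂ t - Ω.f₁ t := by
  obtain ⟨t₀, -, h⟩ := (isCompact_Icc (a := -Ω.L) (b := Ω.L)).exists_isMinOn
    ⟨0, by constructor <;> linarith [Ω.L_pos]⟩
    (Ω.smooth₂.continuous.sub Ω.smooth₁.continuous).continuousOn
  refine ⟨min 2 (Ω.f₂ t₀ - Ω.f₁ t₀), lt_min two_pos (sub_pos.2 (Ω.lt t₀)), fun t => ?_⟩
  rcases le_total |t| Ω.L with ht | ht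
  · exact (min_le_right _ _).trans (h (abs_le.1 ht))
  · rw [Ω.straight₁ t ht, Ω.straight₂ t ht]; exact (min_le_left _ _).trans (by norm_num)

/-! ### Integration over vertical sections -/

theorem slice_integral (F : ℝ × ℝ → ℝ) (t : ℝ) :
    ∫ y, Ω.domain.indicator F (t, y) = ∫ y in Ω.f₁ t..Ω.f₂ t, F (t, y) := by
  rw [intervalIntegral.integral_of_le (Ω.lt t).le, integral_Ioc_eq_integral_Ioo,
    ← integral_indicator measurableSet_Ioo]
  rfl

theorem integrable_slice_integral {F : ℝ × ℝ → ℝ} (hF : IntegrableOn F Ω.domain) :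
    Integrable fun t => ∫ y in Ω.f₁ t..Ω.f₂ t, F (t, y) := by
  have h := (integrable_indicator_iff Ω.measurableSet_domain).2 hF
  rw [Measure.volume_eq_prod] at h
  exact h.integral_prod_left.congr (Eventually.of_forall fun t => Ω.slice_integral F t)

theorem setIntegral_eq_slices {F : ℝ × ℝ → ℝ} (hF : IntegrableOn F Ω.domain) :
    ∫ x in Ω.domain, F x = ∫ t, ∫ y in Ω.f₁ t..Ω.f₂ t, F (t, y) := by
  have h := (integrable_indicator_iff Ω.measurableSet_domain).2 hF
  rw [← integral_indicator Ω.measurableSet_domain]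
  rw [Measure.volume_eq_prod] at h ⊢
  rw [integral_prod _ h]
  exact integral_congr_ae (Eventually.of_forall fun t => Ω.slice_integral F t)

theorem setIntegral_le_of_slices {A B : ℝ × ℝ → ℝ} (hA : IntegrableOn A Ω.domain)
    (hB : IntegrableOn B Ω.domain)
    (h : ∀ t, ∫ y in Ω.f₁ t..Ω.f₂ t, A (t, y) ≤ ∫ y in Ω.f₁ t..Ω.f₂ t, B (t, y)) :
    ∫ x in Ω.domain, A x ≤ ∫ x in Ω.domain, B x := by
  rw [Ω.setIntegral_eq_slices hA, Ω.setIntegral_eq_slices hB]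
  exact integral_mono (Ω.integrable_slice_integral hA) (Ω.integrable_slice_integral hB) h

end Channel

/-! ### Smooth solenoidal fields -/

theorem hasDerivAt_along_curve {φ : ℝ × ℝ → ℝ} (hφ : Differentiable ℝ φ) {γ : ℝ → ℝ} {γ' t : ℝ}
    (hγ : HasDerivAt γ γ' t) :
    HasDerivAt (fun s => φ (s, γ s))
      (partialD 0 φ (t, γ t) + partialD 1 φ (t, γ t) * γ') t := by
  have h : HasDerivAt (fun s => (s, γ s)) ((1 : ℝ), γ') t := (hasDerivAt_id _).prodMk hγ
  refine ((hφ (t, γ t)).hasFDerivAt.comp_hasDerivAt t h).congr_deriv ?_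
  rw [partialD_zero_eq hφ, partialD_one_eq hφ]
  have : ((1 : ℝ), γ') = ((1 : ℝ), (0 : ℝ)) + γ' • ((0 : ℝ), (1 : ℝ)) := by simp
  rw [this, map_add, map_smul, smul_eq_mul, mul_comm]

namespace IsSmoothSolenoidal

variable {Ω : Channel} {u : Fin 2 → ℝ × ℝ → ℝ} (hu : IsSmoothSolenoidal Ω u)
include hu

theorem differentiable (i : Fin 2) : Differentiable ℝ (u i) :=
  (hu.smooth i).differentiable (by simp)

theorem continuous (i : Fin 2) : Continuous (u i) := (hu.smooth i).continuous

theorem upper_eq (t : ℝ) : u 1 (t, Ω.f₂ t) = deriv Ω.f₂ t * u 0 (t, Ω.f₂ t) := by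
  have h := hu.upper t
  have h0 : 0 < √(1 + deriv Ω.f₂ t ^ 2) := Real.sqrt_pos.2 (by positivity)
  simp only [Fin.sum_univ_two, Channel.upperNormal, Matrix.cons_val_zero, Matrix.cons_val_one] at h
  field_simp at h
  linarith

theorem lower_eq (t : ℝ) : u 1 (t, Ω.f₁ t) = deriv Ω.f₁ t * u 0 (t, Ω.f₁ t) := by
  have h := hu.lower t
  have h0 : 0 < √(1 + deriv Ω.f₁ t ^ 2) := Real.sqrt_pos.2 (by positivity)
  simp only [Fin.sum_univ_two, Channel.lowerNormal, Matrix.cons_val_zero, Matrix.cons_val_one] at h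
  field_simp at h
  linarith

/-- The flux through a vertical section has derivative zero. -/
theorem hasDerivAt_flux (t : ℝ) :
    HasDerivAt (fun t => ∫ y in Ω.f₁ t..Ω.f₂ t, u 0 (t, y)) 0 t := by
  have c1 := Ω.smooth₁.continuous
  have c2 := Ω.smooth₂.continuous
  have d1 := Ω.smooth_deriv₁.continuous
  have d2 := Ω.smooth_deriv₂.continuous
  have cu := hu.continuous 0
  have cp0 := continuous_partialD (hu.smooth 0) 0
  have cp1 := continuous_partialD (hu.smooth 0) 1
  -- Rescaling the section to `[0, 1]` fixes the endpoints, so that only differentiation under the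
  -- integral sign is needed.
  let γ : ℝ → ℝ → ℝ := fun t θ => Ω.f₁ t + (Ω.f₂ t - Ω.f₁ t) * θ
  let γ' : ℝ → ℝ → ℝ := fun t θ => deriv Ω.f₁ t + (deriv Ω.f₂ t - deriv Ω.f₁ t) * θ
  let k : ℝ → ℝ → ℝ := fun t θ => (Ω.f₂ t - Ω.f₁ t) * u 0 (t, γ t θ)
  let k' : ℝ → ℝ → ℝ := fun t θ => (deriv Ω.f₂ t - deriv Ω.f₁ t) * u 0 (t, γ t θ) +
    (Ω.f₂ t - Ω.f₁ t) * (partialD 0 (u 0) (t, γ t θ) + partialD 1 (u 0) (t, γ t θ) * γ' t θ)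
  have hflux : (fun t => ∫ y in Ω.f₁ t..Ω.f₂ t, u 0 (t, y)) = fun t => ∫ θ in (0 : ℝ)..1, k t θ := by
    funext t
    simp only [k, γ]
    rw [intervalIntegral.integral_const_mul,
      intervalIntegral.mul_integral_comp_add_mul (f := fun y => u 0 (t, y))]
    simp
  have hγ : ∀ t θ, HasDerivAt (fun t => γ t θ) (γ' t θ) t := fun t θ =>
    (Ω.hasDerivAt₁ t).add (((Ω.hasDerivAt₂ t).sub (Ω.hasDerivAt₁ t)).mul_const θ)
  have hk : Continuous k.uncurry := by
    simp only [k, γ, Function.uncurry_def]; fun_prop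
  have hk' : Continuous k'.uncurry := by
    simp only [k', γ, γ', Function.uncurry_def]; fun_prop
  have hd := hasDerivAt_intervalIntegral_param hk hk' (fun t θ =>
    ((Ω.hasDerivAt₂ t).sub (Ω.hasDerivAt₁ t)).mul
      (hasDerivAt_along_curve (hu.differentiable 0) (hγ t θ))) 0 1 t
  rw [hflux]
  refine hd.congr_deriv ?_
  -- By `div u = 0` the differentiated integrand is the exact `θ`-derivative of `u₁ ∂ₜγ - u₂`, and
  -- tangency at the walls makes this quantity vanish at `θ = 0` and `θ = 1`.
  have hFTC := intervalIntegral.integral_eq_sub_of_hasDerivAt_of_le (zero_le_one' ℝ)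
    (f := fun θ => u 0 (t, γ t θ) * γ' t θ - u 1 (t, γ t θ)) (f' := k' t) ?_ ?_ ?_
  · rw [hFTC]
    have e1 : γ t 1 = Ω.f₂ t := by simp [γ]
    have e0 : γ t 0 = Ω.f₁ t := by simp [γ]
    have e1' : γ' t 1 = deriv Ω.f₂ t := by simp [γ']
    have e0' : γ' t 0 = deriv Ω.f₁ t := by simp [γ']
    simp only [e1, e0, e1', e0', hu.upper_eq, hu.lower_eq]
    ring
  · have := hu.continuous 1
    exact Continuous.continuousOn (by simp only [γ, γ']; fun_prop)
  · intro θ hθ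
    have hl := Ω.lt t
    have g1 : HasDerivAt (fun θ => γ t θ) (Ω.f₂ t - Ω.f₁ t) θ :=
      (((hasDerivAt_id θ).const_mul _).const_add _).congr_deriv (mul_one _)
    have g2 : HasDerivAt (fun θ => γ' t θ) (deriv Ω.f₂ t - deriv Ω.f₁ t) θ :=
      (((hasDerivAt_id θ).const_mul _).const_add _).congr_deriv (mul_one _)
    have a0 := (hasDerivAt_partialD_one (hu.differentiable 0) t (γ t θ)).comp θ g1
    have a1 := (hasDerivAt_partialD_one (hu.differentiable 1) t (γ t θ)).comp θ g1
    have hmem : (t, γ t θ) ∈ Ω.domain := by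
      constructor
      · show Ω.f₁ t < Ω.f₁ t + (Ω.f₂ t - Ω.f₁ t) * θ
        nlinarith [hθ.1]
      · show Ω.f₁ t + (Ω.f₂ t - Ω.f₁ t) * θ < Ω.f₂ t
        nlinarith [hθ.2]
    have hdiv := hu.div_eq_zero _ hmem
    rw [Fin.sum_univ_two] at hdiv
    refine ((a0.mul g2).sub a1).congr_deriv ?_
    simp only [k', Function.comp]
    linear_combination (-(Ω.f₂ t - Ω.f₁ t)) * hdiv
  · exact (hk'.comp (by fun_prop : Continuous fun θ => (t, θ))).intervalIntegrable _ _

/-- The flux through every vertical section vanishes. -/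
theorem flux_eq_zero (t : ℝ) : ∫ y in Ω.f₁ t..Ω.f₂ t, u 0 (t, y) = 0 := by
  set J : ℝ → ℝ := fun t => ∫ y in Ω.f₁ t..Ω.f₂ t, u 0 (t, y) with hJ
  have hconst : ∀ s, J s = J t := fun s => is_const_of_deriv_eq_zero
    (fun s => (hu.hasDerivAt_flux s).differentiableAt) (fun s => (hu.hasDerivAt_flux s).deriv) s t
  obtain ⟨M, hM, hb⟩ := Ω.exists_bounds
  have hint : IntegrableOn (fun x => u 0 x ^ 2) Ω.domain := (hu.memLp 0).integrable_sq
  -- By Cauchy–Schwarz the squared flux is at most `M` times the integral of `u₁²` over the section,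
  -- which is integrable along the channel. A constant integrable on a line of infinite measure is
  -- zero.
  have h1 : Integrable fun _ : ℝ => J t ^ 2 := by
    refine ((Ω.integrable_slice_integral hint).const_mul M).mono' (by fun_prop)
      (Eventually.of_forall fun s => ?_)
    rw [Real.norm_of_nonneg (sq_nonneg _), ← hconst s]
    exact sq_integral_le ((hu.continuous 0).comp (by fun_prop)) (Ω.lt s).le (hb s).2.2.1
      (by linarith)
  have h2 := integrable_const_iff.1 h1
  rcases h2 with h2 | h2
  · exact pow_eq_zero_iff two_ne_zero |>.1 h2
  · exact absurd h2 (by simp [isFiniteMeasure_iff])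

end IsSmoothSolenoidal

end SlipChannel

namespace SlipChannel

/-! ### Hardy and Poincaré inequalities for solenoidal fields with slip -/

/-- The component of `u` along `(-f₂', 1)`, which is normal to the translates of the upper wall. -/
noncomputable def crossComponent (Ω : Channel) (u : Fin 2 → ℝ × ℝ → ℝ) (x : ℝ × ℝ) : ℝ :=
  u 1 x - deriv Ω.f₂ x.1 * u 0 x

/-- The vertical derivative of `crossComponent`. -/
noncomputable def crossComponentDeriv (Ω : Channel) (u : Fin 2 → ℝ × ℝ → ℝ) (x : ℝ × ℝ) : ℝ :=
  partialD 1 (u 1) x - deriv Ω.f₂ x.1 * partialD 1 (u 0) x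

theorem memLp_bdd_mul {Ω : Channel} {b f : ℝ × ℝ → ℝ} {B : ℝ}
    (hb : AEStronglyMeasurable b (volume.restrict Ω.domain)) (hB : ∀ x ∈ Ω.domain, |b x| ≤ B)
    (hf : MemLp f 2 (volume.restrict Ω.domain)) :
    MemLp (fun x => b x * f x) 2 (volume.restrict Ω.domain) := by
  refine hf.of_le_mul (c := B) (hb.mul hf.1) ?_
  filter_upwards [ae_restrict_mem Ω.measurableSet_domain] with x hx
  rw [norm_mul]
  exact mul_le_mul_of_nonneg_right (hB x hx) (norm_nonneg _)

namespace IsSmoothSolenoidal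

variable {Ω : Channel} {u : Fin 2 → ℝ × ℝ → ℝ} (hu : IsSmoothSolenoidal Ω u)
include hu

theorem hasDerivAt_crossComponent (t y : ℝ) :
    HasDerivAt (fun y => crossComponent Ω u (t, y)) (crossComponentDeriv Ω u (t, y)) y :=
  (hasDerivAt_partialD_one (hu.differentiable 1) t y).sub
    ((hasDerivAt_partialD_one (hu.differentiable 0) t y).const_mul (deriv Ω.f₂ t))

theorem continuous_crossComponent : Continuous (crossComponent Ω u) :=
  (hu.continuous 1).sub ((Ω.smooth_deriv₂.continuous.comp continuous_fst).mul (hu.continuous 0))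

theorem continuous_crossComponentDeriv : Continuous (crossComponentDeriv Ω u) :=
  (continuous_partialD (hu.smooth 1) 1).sub
    ((Ω.smooth_deriv₂.continuous.comp continuous_fst).mul (continuous_partialD (hu.smooth 0) 1))

theorem memLp_crossComponent :
    MemLp (crossComponent Ω u) 2 (volume.restrict Ω.domain) := by
  obtain ⟨M, -, hb⟩ := Ω.exists_bounds
  exact (hu.memLp 1).sub (memLp_bdd_mul
    (Ω.smooth_deriv₂.continuous.comp continuous_fst).aestronglyMeasurable
    (fun x _ => (hb x.1).2.2.2.1) (hu.memLp 0))

theorem memLp_crossComponentDeriv :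
    MemLp (crossComponentDeriv Ω u) 2 (volume.restrict Ω.domain) := by
  obtain ⟨M, -, hb⟩ := Ω.exists_bounds
  exact (hu.memLp_grad 1 1).sub (memLp_bdd_mul
    (Ω.smooth_deriv₂.continuous.comp continuous_fst).aestronglyMeasurable
    (fun x _ => (hb x.1).2.2.2.1) (hu.memLp_grad 0 1))

theorem integrable_gradSq : IntegrableOn (gradSq u) Ω.domain :=
  integrable_finsetSum _ fun i _ => integrable_finsetSum _ fun j _ => (hu.memLp_grad i j).integrable_sq

omit hu in
theorem _root_.SlipChannel.crossComponentDeriv_sq_le {M : ℝ} {x : ℝ × ℝ}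
    (hM : |deriv Ω.f₂ x.1| ≤ M) :
    crossComponentDeriv Ω u x ^ 2 ≤ 2 * (1 + M ^ 2) * gradSq u x := by
  have h1 : deriv Ω.f₂ x.1 ^ 2 ≤ M ^ 2 := sq_le_sq' (by linarith [(abs_le.1 hM).1]) (abs_le.1 hM).2
  simp only [crossComponentDeriv, gradSq, Fin.sum_univ_two]
  set a := partialD 1 (u 1) x
  set b := partialD 1 (u 0) x
  set β := deriv Ω.f₂ x.1
  have h2 : (a - β * b) ^ 2 ≤ 2 * a ^ 2 + 2 * (β ^ 2 * b ^ 2) := by nlinarith [sq_nonneg (a + β * b)]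
  have h3 : β ^ 2 * b ^ 2 ≤ M ^ 2 * b ^ 2 := by gcongr
  nlinarith [sq_nonneg a, sq_nonneg b, mul_nonneg (sq_nonneg M) (sq_nonneg a),
    mul_nonneg (sq_nonneg M) (sq_nonneg (partialD 0 (u 0) x)),
    mul_nonneg (sq_nonneg M) (sq_nonneg (partialD 0 (u 1) x)),
    sq_nonneg (partialD 0 (u 0) x), sq_nonneg (partialD 0 (u 1) x)]

theorem integral_crossComponentDeriv_sq_le {M : ℝ} (hM : ∀ t, |deriv Ω.f₂ t| ≤ M) :
    ∫ x in Ω.domain, crossComponentDeriv Ω u x ^ 2 ≤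
      2 * (1 + M ^ 2) * ∫ x in Ω.domain, gradSq u x := by
  rw [← integral_const_mul]
  exact setIntegral_mono hu.memLp_crossComponentDeriv.integrable_sq
    (hu.integrable_gradSq.const_mul _) fun x => crossComponentDeriv_sq_le (hM x.1)

theorem integrable_hardy {κ : ℝ} (hκ : 0 < κ) :
    IntegrableOn (fun x => crossComponent Ω u x ^ 2 / (Ω.f₂ x.1 - x.2 + κ) ^ 2) Ω.domain := by
  refine (hu.memLp_crossComponent.integrable_sq.const_mul (1 / κ ^ 2)).mono' ?_ ?_
  · have h1 := hu.continuous_crossComponent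
    have h2 := Ω.smooth₂.continuous
    have : Measurable fun x : ℝ × ℝ => crossComponent Ω u x ^ 2 / (Ω.f₂ x.1 - x.2 + κ) ^ 2 :=
      (h1.pow 2).measurable.div (by fun_prop : Continuous _).measurable
    exact this.aestronglyMeasurable
  · filter_upwards [ae_restrict_mem Ω.measurableSet_domain] with x hx
    rw [Real.norm_of_nonneg (by positivity), div_eq_mul_one_div, mul_comm]
    have : κ ≤ Ω.f₂ x.1 - x.2 + κ := by linarith [hx.2]
    gcongr

/-- Hardy's inequality at the upper wall. -/
theorem hardy {M κ : ℝ} (hM : ∀ t, |deriv Ω.f₂ t| ≤ M) (hκ : 0 < κ) :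
    ∫ x in Ω.domain, crossComponent Ω u x ^ 2 / (Ω.f₂ x.1 - x.2 + κ) ^ 2 ≤
      8 * (1 + M ^ 2) * ∫ x in Ω.domain, gradSq u x := by
  have h : ∫ x in Ω.domain, crossComponent Ω u x ^ 2 / (Ω.f₂ x.1 - x.2 + κ) ^ 2 ≤
      ∫ x in Ω.domain, 4 * crossComponentDeriv Ω u x ^ 2 := by
    refine Ω.setIntegral_le_of_slices (hu.integrable_hardy hκ)
      (hu.memLp_crossComponentDeriv.integrable_sq.const_mul 4) fun t => ?_
    rw [intervalIntegral.integral_const_mul]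
    exact hardy_interval (hu.hasDerivAt_crossComponent t)
      (hu.continuous_crossComponentDeriv.comp (by fun_prop)) (Ω.lt t).le hκ
      (by simp [crossComponent, hu.upper_eq])
  rw [integral_const_mul] at h
  linarith [hu.integral_crossComponentDeriv_sq_le hM]

/-- Slip leaves the horizontal component free at the walls; its zero flux supplies the mean-zero
condition on each vertical section instead. -/
theorem poincare_zero {M : ℝ} (hM : ∀ t, Ω.f₂ t - Ω.f₁ t ≤ M) :
    ∫ x in Ω.domain, u 0 x ^ 2 ≤ 4 * (M + 1) ^ 2 * ∫ x in Ω.domain, gradSq u x := by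
  have h : ∫ x in Ω.domain, u 0 x ^ 2 ≤
      ∫ x in Ω.domain, 4 * (M + 1) ^ 2 * partialD 1 (u 0) x ^ 2 := by
    refine Ω.setIntegral_le_of_slices (hu.memLp 0).integrable_sq
      ((hu.memLp_grad 0 1).integrable_sq.const_mul _) fun t => ?_
    rw [intervalIntegral.integral_const_mul]
    exact poincare_interval_of_mean (hasDerivAt_partialD_one (hu.differentiable 0) t)
      ((continuous_partialD (hu.smooth 0) 1).comp (by fun_prop)) (Ω.lt t).le (hM t)
      (hu.flux_eq_zero t)
  rw [integral_const_mul] at h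
  refine h.trans ?_
  gcongr ?_ * ?_
  refine setIntegral_mono (hu.memLp_grad 0 1).integrable_sq hu.integrable_gradSq fun x => ?_
  simp only [gradSq, Fin.sum_univ_two]
  nlinarith [sq_nonneg (partialD 0 (u 0) x), sq_nonneg (partialD 0 (u 1) x),
    sq_nonneg (partialD 1 (u 1) x)]

/-- Tangency makes this component vanish at the top of each vertical section, so the one-ended
Poincaré inequality applies. -/
theorem poincare_cross {M : ℝ} (hM : ∀ t, Ω.f₂ t - Ω.f₁ t ≤ M) (hM' : ∀ t, |deriv Ω.f₂ t| ≤ M) :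
    ∫ x in Ω.domain, crossComponent Ω u x ^ 2 ≤
      8 * (M + 1) ^ 2 * (1 + M ^ 2) * ∫ x in Ω.domain, gradSq u x := by
  have h : ∫ x in Ω.domain, crossComponent Ω u x ^ 2 ≤
      ∫ x in Ω.domain, 4 * (M + 1) ^ 2 * crossComponentDeriv Ω u x ^ 2 := by
    refine Ω.setIntegral_le_of_slices hu.memLp_crossComponent.integrable_sq
      (hu.memLp_crossComponentDeriv.integrable_sq.const_mul _) fun t => ?_
    rw [intervalIntegral.integral_const_mul]
    exact poincare_interval_of_end (hu.hasDerivAt_crossComponent t)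
      (hu.continuous_crossComponentDeriv.comp (by fun_prop)) (Ω.lt t).le (hM t)
      (by simp [crossComponent, hu.upper_eq])
  rw [integral_const_mul] at h
  have h2 := mul_le_mul_of_nonneg_left (hu.integral_crossComponentDeriv_sq_le hM')
    (by positivity : 0 ≤ 4 * (M + 1) ^ 2)
  linarith

end IsSmoothSolenoidal

/-- The vertical component is recovered from the two controlled quantities as `crossComponent + f₂'
u₁`, with `f₂'` bounded. -/
theorem exists_poincare (Ω : Channel) : ∃ P, 0 < P ∧ ∀ u, IsSmoothSolenoidal Ω u →
    ∫ x in Ω.domain, (u 0 x ^ 2 + u 1 x ^ 2) ≤ P * ∫ x in Ω.domain, gradSq u x := by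
  obtain ⟨M, hM, hb⟩ := Ω.exists_bounds
  refine ⟨(1 + 2 * M ^ 2) * (4 * (M + 1) ^ 2) + 2 * (8 * (M + 1) ^ 2 * (1 + M ^ 2)),
    by positivity, fun u hu => ?_⟩
  have h0 := hu.poincare_zero fun t => (hb t).2.2.1
  have h1 := hu.poincare_cross (fun t => (hb t).2.2.1) fun t => (hb t).2.2.2.1
  have hle : ∫ x in Ω.domain, (u 0 x ^ 2 + u 1 x ^ 2) ≤
      ∫ x in Ω.domain, ((1 + 2 * M ^ 2) * u 0 x ^ 2 + 2 * crossComponent Ω u x ^ 2) := by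
    refine setIntegral_mono ((hu.memLp 0).integrable_sq.add (hu.memLp 1).integrable_sq)
      (((hu.memLp 0).integrable_sq.const_mul _).add
        (hu.memLp_crossComponent.integrable_sq.const_mul _)) fun x => ?_
    have hβ := (hb x.1).2.2.2.1
    have h1 : deriv Ω.f₂ x.1 ^ 2 ≤ M ^ 2 :=
      sq_le_sq' (by linarith [(abs_le.1 hβ).1]) (abs_le.1 hβ).2
    have h3 : deriv Ω.f₂ x.1 ^ 2 * u 0 x ^ 2 ≤ M ^ 2 * u 0 x ^ 2 := by gcongr
    simp only [crossComponent]
    nlinarith [sq_nonneg (u 1 x - 2 * (deriv Ω.f₂ x.1 * u 0 x))]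
  rw [integral_add ((hu.memLp 0).integrable_sq.const_mul _)
    (hu.memLp_crossComponent.integrable_sq.const_mul _), integral_const_mul,
    integral_const_mul] at hle
  have h0' := mul_le_mul_of_nonneg_left h0 (by positivity : 0 ≤ 1 + 2 * M ^ 2)
  linarith

end SlipChannel

namespace SlipChannel

/-! ### The boundary-layer profile extended to the whole line -/

/-- `m` is a smooth profile on the line with transition layer in `[η, ε]` and slope at most
`ε / t`. -/
structure IsProfile (m : ℝ → ℝ) (ε η : ℝ) : Prop where
  pos : 0 < η
  smooth : ContDiff ℝ ∞ m
  mem : ∀ t, m t ∈ Icc (0 : ℝ) 1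
  deriv_left : ∀ t, t < η → deriv m t = 0
  deriv_right : ∀ t, ε < t → deriv m t = 0
  abs_deriv_le : ∀ t, 0 < t → |deriv m t| ≤ ε / t

/-- Since `mu` equals `1` near `0`, continuing it by `1` to the negative axis keeps it smooth. The
carrier then extends across the upper wall to a smooth field on the plane. -/
theorem CutoffFamily.exists_profile (c : CutoffFamily) {ε : ℝ} (hε : 0 < ε) :
    ∃ m η, IsProfile m ε η ∧ ∀ t, 0 < t → m =ᶠ[𝓝 t] c.mu ε := by
  obtain ⟨η, hη, h1⟩ := c.mu_near_zero ε hε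
  let m : ℝ → ℝ := fun t => if t ≤ 0 then 1 else c.mu ε t
  have hpos : ∀ t, 0 < t → m =ᶠ[𝓝 t] c.mu ε := fun t ht => by
    filter_upwards [lt_mem_nhds ht] with s hs
    simp [m, hs.not_ge]
  have hone : ∀ t, t < η → m =ᶠ[𝓝 t] fun _ => 1 := fun t ht => by
    filter_upwards [gt_mem_nhds ht] with s hs
    by_cases h : s ≤ 0
    · simp [m, h]
    · simp [m, h, h1 s ⟨(not_le.1 h).le, hs.le⟩]
  refine ⟨m, η, ⟨hη, ?_, ?_, ?_, ?_, ?_⟩, hpos⟩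
  · refine contDiff_iff_contDiffAt.2 fun t => ?_
    rcases lt_or_ge t η with h | h
    · exact contDiffAt_const.congr_of_eventuallyEq (hone t h)
    · have ht : 0 < t := hη.trans_le h
      exact ((c.mu_smooth ε hε).contDiffAt (Ici_mem_nhds ht)).congr_of_eventuallyEq (hpos t ht)
  · intro t
    by_cases h : t ≤ 0
    · simp [m, h]
    · simp only [m, h, if_false]; exact c.mu_mem ε hε t (not_le.1 h).le
  · intro t ht
    rw [(hone t ht).deriv_eq, deriv_const]
  · intro t ht
    rw [(hpos t (hε.trans ht)).deriv_eq]
    have : c.mu ε =ᶠ[𝓝 t] fun _ => 0 := by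
      filter_upwards [lt_mem_nhds ht] with s hs using c.mu_eq_zero ε hε s hs.le
    rw [this.deriv_eq, deriv_const]
  · intro t ht
    rw [(hpos t ht).deriv_eq, ← abs_neg, abs_of_nonneg (c.mu_deriv ε hε t ht).1]
    exact (c.mu_deriv ε hε t ht).2

namespace IsProfile

variable {m : ℝ → ℝ} {ε η : ℝ} (hm : IsProfile m ε η)
include hm

theorem smooth_deriv : ContDiff ℝ ∞ (deriv m) := (contDiff_infty_iff_deriv.1 hm.smooth).2

theorem hasDerivAt (t : ℝ) : HasDerivAt m (deriv m t) t :=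
  (hm.smooth.differentiable (by simp) t).hasDerivAt

theorem hasDerivAt_deriv (t : ℝ) : HasDerivAt (deriv m) (deriv (deriv m) t) t :=
  (hm.smooth_deriv.differentiable (by simp) t).hasDerivAt

theorem abs_deriv_le_bound (hε : 0 < ε) (t : ℝ) : |deriv m t| ≤ ε / η := by
  rcases lt_or_ge t η with h | h
  · rw [hm.deriv_left t h, abs_zero]; exact div_nonneg hε.le hm.pos.le
  · have := hm.pos
    exact (hm.abs_deriv_le t (hm.pos.trans_le h)).trans (by gcongr)

/-- The derivative vanishes for `t < η`, and `t + η ≤ 2t` otherwise. The shift makes the bound match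
the regularised Hardy weight with `κ = η`, which has no singularity at the wall. -/
theorem abs_deriv_le_shifted (hε : 0 < ε) {t : ℝ} (ht : 0 < t) :
    |deriv m t| ≤ 2 * ε / (t + η) := by
  have := hm.pos
  rcases lt_or_ge t η with h | h
  · rw [hm.deriv_left t h, abs_zero]; positivity
  · refine (hm.abs_deriv_le t ht).trans ?_
    rw [div_le_div_iff₀ ht (by positivity)]
    nlinarith

end IsProfile

/-! ### The horizontal cut-off -/

namespace CutoffFamily

variable (c : CutoffFamily) {d : ℝ} (hd : 0 < d)
include hd

theorem smooth_deriv_pi : ContDiff ℝ ∞ (deriv (c.pi d)) :=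
  (contDiff_infty_iff_deriv.1 (c.pi_smooth d hd)).2

theorem hasDerivAt_pi (t : ℝ) : HasDerivAt (c.pi d) (deriv (c.pi d) t) t :=
  ((c.pi_smooth d hd).differentiable (by simp) t).hasDerivAt

theorem hasDerivAt_deriv_pi (t : ℝ) :
    HasDerivAt (deriv (c.pi d)) (deriv (deriv (c.pi d)) t) t :=
  ((c.smooth_deriv_pi hd).differentiable (by simp) t).hasDerivAt

theorem deriv_pi_eq_zero {t : ℝ} (ht : |t| < 5 * d / 4) : deriv (c.pi d) t = 0 := by
  have : c.pi d =ᶠ[𝓝 t] fun _ => 0 := by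
    filter_upwards [(isOpen_lt continuous_abs continuous_const).mem_nhds ht] with s hs
      using c.pi_eq_zero d hd s (le_of_lt hs)
  rw [this.deriv_eq, deriv_const]

theorem deriv_deriv_pi_eq_zero {t : ℝ} (ht : |t| < 5 * d / 4) :
    deriv (deriv (c.pi d)) t = 0 := by
  have : deriv (c.pi d) =ᶠ[𝓝 t] fun _ => 0 := by
    filter_upwards [(isOpen_lt continuous_abs continuous_const).mem_nhds ht] with s hs
      using c.deriv_pi_eq_zero hd hs
  rw [this.deriv_eq, deriv_const]

theorem deriv_pi_eq_zero_of_large {t : ℝ} (ht : 7 * d / 4 < |t|) : deriv (c.pi d) t = 0 :=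
  deriv_eq_zero_of_const_outside (fun s hs => c.pi_eq_one d hd s hs.le) ht

omit hd in
/-- The horizontal cut-off is inactive or the upper wall is flat. -/
theorem inactive_or_flat {Ω : Channel} (hd : Ω.L < d) (t : ℝ) :
    (c.pi d t = 0 ∧ deriv (c.pi d) t = 0 ∧ deriv (deriv (c.pi d)) t = 0) ∨
      (deriv Ω.f₂ t = 0 ∧ deriv (deriv Ω.f₂) t = 0) := by
  have hd0 : 0 < d := Ω.L_pos.trans hd
  rcases lt_or_ge |t| (5 * d / 4) with h | h
  · exact Or.inl ⟨c.pi_eq_zero d hd0 t h.le, c.deriv_pi_eq_zero hd0 h,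
      c.deriv_deriv_pi_eq_zero hd0 h⟩
  · have : Ω.L < |t| := by linarith
    exact Or.inr ⟨Ω.deriv₂_eq_zero this, Ω.deriv_deriv₂_eq_zero this⟩

end CutoffFamily

/-! ### The flux carrier as a smooth field on the plane -/

/-- The flux carrier for `Φ = 1`, with profile `m` and horizontal cut-off `p`, on the plane. -/
noncomputable def unitCarrier (Ω : Channel) (m p : ℝ → ℝ) : Fin 2 → ℝ × ℝ → ℝ :=
  ![fun x => -((1 - p x.1) * deriv m (Ω.f₂ x.1 - x.2)) + p x.1 / 2,
    fun x => -(deriv m (Ω.f₂ x.1 - x.2) * deriv Ω.f₂ x.1) +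
      deriv p x.1 * (m (Ω.f₂ x.1 - x.2) - (x.2 + 1) / 2)]

theorem hasDerivAt_comp_depth_fst {Ω : Channel} {k k' : ℝ → ℝ} (hk : ∀ t, HasDerivAt k (k' t) t)
    (t y : ℝ) : HasDerivAt (fun t => k (Ω.f₂ t - y)) (k' (Ω.f₂ t - y) * deriv Ω.f₂ t) t :=
  (hk _).comp t ((Ω.hasDerivAt₂ t).sub_const y)

theorem hasDerivAt_comp_depth_snd {Ω : Channel} {k k' : ℝ → ℝ} (hk : ∀ t, HasDerivAt k (k' t) t)
    (t y : ℝ) : HasDerivAt (fun y => k (Ω.f₂ t - y)) (-k' (Ω.f₂ t - y)) y :=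
  ((hk _).comp y ((hasDerivAt_id y).const_sub _)).congr_deriv (by simp)

section carrier

variable {Ω : Channel} {c : CutoffFamily} {m : ℝ → ℝ} {ε η d : ℝ}

theorem smooth_unitCarrier (hm : IsProfile m ε η) (hd : 0 < d) (i : Fin 2) :
    ContDiff ℝ ∞ (unitCarrier Ω m (c.pi d) i) := by
  have h1 := hm.smooth
  have h2 := hm.smooth_deriv
  have h3 := c.pi_smooth d hd
  have h4 := c.smooth_deriv_pi hd
  have h5 := Ω.smooth₂
  have h6 := Ω.smooth_deriv₂
  fin_cases i
  · simp only [unitCarrier, Fin.zero_eta, Matrix.cons_val_zero]; fun_prop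
  · simp only [unitCarrier, Fin.mk_one, Matrix.cons_val_one, Matrix.cons_val_fin_one]; fun_prop

/-- The unified formula adds both branches of the second component: for `|x₁| < d` the term with
`π'` vanishes, and for `|x₁| ≥ d > L` the term with `f₂'` does. -/
theorem carrier_eq_unitCarrier (hm : IsProfile m ε η) (hmu : ∀ t, 0 < t → m =ᶠ[𝓝 t] c.mu ε)
    (hd : Ω.L < d) (Φ : ℝ) (i : Fin 2) {x : ℝ × ℝ} (hx : x ∈ Ω.domain) :
    carrier Ω c Φ ε d i x = Φ * unitCarrier Ω m (c.pi d) i x := by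
  have hd0 : 0 < d := Ω.L_pos.trans hd
  have hpot : ∀ y ∈ Ω.domain, potential Ω c Φ ε y = Φ * m (Ω.f₂ y.1 - y.2) := fun y hy => by
    rw [potential, (hmu _ (sub_pos.2 hy.2)).self_of_nhds]
  have hev : potential Ω c Φ ε =ᶠ[𝓝 x] fun y => Φ * m (Ω.f₂ y.1 - y.2) := by
    filter_upwards [Ω.isOpen_domain.mem_nhds hx] with y hy using hpot y hy
  have e0 : partialD 0 (potential Ω c Φ ε) x =
      Φ * (deriv m (Ω.f₂ x.1 - x.2) * deriv Ω.f₂ x.1) := by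
    rw [partialD_congr hev]
    exact ((hasDerivAt_comp_depth_fst hm.hasDerivAt x.1 x.2).const_mul Φ).deriv
  have e1 : partialD 1 (potential Ω c Φ ε) x = Φ * (-deriv m (Ω.f₂ x.1 - x.2)) := by
    rw [partialD_congr hev]
    exact ((hasDerivAt_comp_depth_snd hm.hasDerivAt x.1 x.2).const_mul Φ).deriv
  fin_cases i
  · simp only [carrier, unitCarrier, Fin.zero_eta, Matrix.cons_val_zero, e1]
    ring
  · simp only [carrier, unitCarrier, Fin.mk_one, Matrix.cons_val_one, Matrix.cons_val_fin_one, e0, hpot x hx]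
    split_ifs with h
    · rw [c.deriv_pi_eq_zero hd0 (by linarith)]; ring
    · rw [Ω.deriv₂_eq_zero (hd.trans_le (not_lt.1 h))]; ring

theorem partialD_carrier (hm : IsProfile m ε η) (hmu : ∀ t, 0 < t → m =ᶠ[𝓝 t] c.mu ε)
    (hd : Ω.L < d) (Φ : ℝ) (i j : Fin 2) {x : ℝ × ℝ} (hx : x ∈ Ω.domain) :
    partialD j (carrier Ω c Φ ε d i) x = Φ * partialD j (unitCarrier Ω m (c.pi d) i) x := by
  rw [← partialD_const_mul]
  refine partialD_congr ?_ j
  filter_upwards [Ω.isOpen_domain.mem_nhds hx] with y hy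
    using carrier_eq_unitCarrier hm hmu hd Φ i hy

/-- Beyond the transition region the field is the constant `(1/2, 0)`. -/
theorem partialD_unitCarrier_eq_zero (hd : Ω.L < d) (i j : Fin 2) {x : ℝ × ℝ}
    (hx : 7 * d / 4 < |x.1|) : partialD j (unitCarrier Ω m (c.pi d) i) x = 0 := by
  have hd0 : 0 < d := Ω.L_pos.trans hd
  have : unitCarrier Ω m (c.pi d) i =ᶠ[𝓝 x] fun _ => ![1 / 2, 0] i := by
    filter_upwards [(isOpen_lt continuous_const continuous_fst.abs).mem_nhds hx] with y hy
    have hy' : 7 * d / 4 < |y.1| := hy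
    fin_cases i
    · simp [unitCarrier, c.pi_eq_one d hd0 _ hy'.le]
    · simp [unitCarrier, c.deriv_pi_eq_zero_of_large hd0 hy',
        Ω.deriv₂_eq_zero (show Ω.L < |y.1| by linarith)]
  rw [partialD_congr this]
  fin_cases j <;> simp [partialD]

end carrier

/-! ### Bounded pieces of the channel and the estimate of the carrier itself -/

/-- A compact rectangle containing the part of the channel over `[-R, R]`. -/
theorem Channel.exists_compact (Ω : Channel) (R : ℝ) : ∃ K : Set (ℝ × ℝ), IsCompact K ∧
    ∀ x ∈ Ω.domain, |x.1| ≤ R → x ∈ K := by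
  obtain ⟨M, -, hb⟩ := Ω.exists_bounds
  refine ⟨Icc (-R) R ×ˢ Icc (-M) M, isCompact_Icc.prod isCompact_Icc, fun x hx h => ?_⟩
  have h1 := abs_le.1 (hb x.1).1
  have h2 := abs_le.1 (hb x.1).2.1
  exact ⟨abs_le.1 h, by linarith [hx.1], by linarith [hx.2]⟩

theorem Channel.integrableOn_of_continuous (Ω : Channel) {F : ℝ × ℝ → ℝ} (hF : Continuous F)
    {R : ℝ} (h0 : ∀ x, R < |x.1| → F x = 0) : IntegrableOn F Ω.domain := by
  obtain ⟨K, hK, hKR⟩ := Ω.exists_compact R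
  refine (hF.continuousOn.integrableOn_compact hK).of_forall_sdiff_eq_zero
    Ω.measurableSet_domain fun x hx => h0 x ?_
  by_contra h
  exact hx.2 (hKR x hx.1 (not_lt.1 h))

theorem Channel.exists_bound_of_continuous (Ω : Channel) {F : ℝ × ℝ → ℝ} (hF : Continuous F)
    {R : ℝ} (h0 : ∀ x, R < |x.1| → F x = 0) : ∃ B, ∀ x ∈ Ω.domain, |F x| ≤ B := by
  obtain ⟨K, hK, hKR⟩ := Ω.exists_compact R
  obtain ⟨B, hB⟩ := hK.exists_bound_of_continuousOn hF.continuousOn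
  refine ⟨max B 0, fun x hx => ?_⟩
  rcases le_or_gt |x.1| R with h | h
  · exact (hB x (hKR x hx h)).trans (le_max_left _ _)
  · rw [h0 x h, abs_zero]; exact le_max_right _ _

/-- Homogeneity in `Φ` reduces everything to the unit carrier, whose two densities are continuous
and vanish for `|x₁| > 7d/4`. The sum of their integrals serves as the constant. -/
theorem carrier_estimate (Ω : Channel) (c : CutoffFamily) {ε d : ℝ} (hε : 0 < ε) (hd : Ω.L < d) :
    ∃ C : ℝ, ∀ Φ : ℝ, IntegrableOn (fun x => gradSq (carrier Ω c Φ ε d) x +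
        convectionSq (carrier Ω c Φ ε d) x) Ω.domain ∧
      ∫ x in Ω.domain, (gradSq (carrier Ω c Φ ε d) x + convectionSq (carrier Ω c Φ ε d) x)
        ≤ C * (Φ ^ 2 + Φ ^ 4) := by
  obtain ⟨m, η, hm, hmu⟩ := c.exists_profile hε
  have hd0 : 0 < d := Ω.L_pos.trans hd
  set h := unitCarrier Ω m (c.pi d) with hh
  have hcont : ∀ i, Continuous (h i) := fun i => (smooth_unitCarrier hm hd0 i).continuous
  have hcontD : ∀ i j, Continuous (partialD j (h i)) :=
    fun i j => continuous_partialD (smooth_unitCarrier hm hd0 i) j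
  have hz : ∀ i j x, 7 * d / 4 < |x.1| → partialD j (h i) x = 0 :=
    fun i j x hx => partialD_unitCarrier_eq_zero hd i j hx
  have i1 : IntegrableOn (gradSq h) Ω.domain := by
    refine Ω.integrableOn_of_continuous (R := 7 * d / 4) ?_ fun x hx => ?_
    · unfold gradSq; fun_prop
    · simp [gradSq, hz _ _ x hx]
  have i2 : IntegrableOn (convectionSq h) Ω.domain := by
    refine Ω.integrableOn_of_continuous (R := 7 * d / 4) ?_ fun x hx => ?_
    · unfold convectionSq; fun_prop
    · simp [convectionSq, hz _ _ x hx]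
  refine ⟨∫ x in Ω.domain, (gradSq h x + convectionSq h x), fun Φ => ?_⟩
  have heq : EqOn (fun x => gradSq (carrier Ω c Φ ε d) x + convectionSq (carrier Ω c Φ ε d) x)
      (fun x => Φ ^ 2 * gradSq h x + Φ ^ 4 * convectionSq h x) Ω.domain := fun x hx => by
    simp only [gradSq, convectionSq, Fin.sum_univ_two, partialD_carrier hm hmu hd Φ _ _ hx,
      carrier_eq_unitCarrier hm hmu hd Φ _ hx, ← hh]
    ring
  refine ⟨IntegrableOn.congr_fun ((i1.const_mul _).add (i2.const_mul _)) heq.symm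
    Ω.measurableSet_domain, ?_⟩
  rw [setIntegral_congr_fun Ω.measurableSet_domain heq, integral_add (i1.const_mul _)
    (i2.const_mul _), integral_const_mul, integral_const_mul, integral_add i1 i2]
  have n1 : 0 ≤ ∫ x in Ω.domain, gradSq h x := integral_nonneg fun x => by
    simp only [gradSq]; positivity
  have n2 : 0 ≤ ∫ x in Ω.domain, convectionSq h x := integral_nonneg fun x => by
    simp only [convectionSq]; positivity
  nlinarith [mul_nonneg n1 (by positivity : 0 ≤ Φ ^ 4), mul_nonneg n2 (sq_nonneg Φ)]

end SlipChannel

namespace SlipChannel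

/-! ### Integrals of derivatives of functions supported in the boundary layer -/

theorem integral_partialD_eq_zero {F : ℝ × ℝ → ℝ} (hF : ContDiff ℝ ∞ F)
    (hc : HasCompactSupport F) (j : Fin 2) : ∫ x, partialD j F x = 0 := by
  have hd : Differentiable ℝ F := hF.differentiable (by simp)
  have key : ∀ v : ℝ × ℝ, ∫ x, fderiv ℝ F x v = 0 := fun v => by
    have hi : Integrable fun x => fderiv ℝ F x v :=
      ((hF.continuous_fderiv (by simp)).clm_apply continuous_const).integrable_of_hasCompactSupport
        ((hc.fderiv ℝ).comp_left (g := fun T : ℝ × ℝ →L[ℝ] ℝ => T v) rfl)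
    have h := integral_mul_fderiv_eq_neg_fderiv_mul_of_integrable (𝕜 := ℝ)
      (μ := (volume : Measure (ℝ × ℝ))) (f := fun _ => (1 : ℝ)) (g := F) (v := v)
      (by simp) (by simpa using hi)
      (by simpa using hF.continuous.integrable_of_hasCompactSupport hc) (fun _ _ => by fun_prop) (fun x _ => hd x)
    simpa using h
  fin_cases j
  · simp only [Fin.zero_eta, partialD_zero_eq hd]; exact key _
  · simp only [Fin.mk_one, partialD_one_eq hd]; exact key _

/-- The layer `η ≤ f₂ - x₂ ≤ ε`, cut at `|x₁| ≤ R`, is a compact subset of the open channel: `η > 0`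
keeps it off the upper wall, and `ε` below the width keeps it off the lower one. No boundary terms
arise. -/
theorem Channel.setIntegral_partialD_eq_zero (Ω : Channel) {F : ℝ × ℝ → ℝ}
    (hF : ContDiff ℝ ∞ F) {R ε η : ℝ} (hη : 0 < η) (hε : ∀ t, ε < Ω.f₂ t - Ω.f₁ t)
    (h0 : ∀ x, F x ≠ 0 → |x.1| ≤ R ∧ η ≤ Ω.f₂ x.1 - x.2 ∧ Ω.f₂ x.1 - x.2 ≤ ε) (j : Fin 2) :
    IntegrableOn (partialD j F) Ω.domain ∧ ∫ x in Ω.domain, partialD j F x = 0 := by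
  let Z : Set (ℝ × ℝ) := {x | |x.1| ≤ R ∧ η ≤ Ω.f₂ x.1 - x.2 ∧ Ω.f₂ x.1 - x.2 ≤ ε}
  have hcont : Continuous fun x : ℝ × ℝ => Ω.f₂ x.1 - x.2 :=
    (Ω.smooth₂.continuous.comp continuous_fst).sub continuous_snd
  have hZ : IsClosed Z := (isClosed_le continuous_fst.abs continuous_const).inter
    ((isClosed_le continuous_const hcont).inter (isClosed_le hcont continuous_const))
  have hZΩ : Z ⊆ Ω.domain := fun x hx => by
    obtain ⟨-, h1, h2⟩ := hx
    exact ⟨by linarith [hε x.1], by linarith⟩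
  obtain ⟨K, hK, hKR⟩ := Ω.exists_compact R
  have hZK : Z ⊆ K := fun x hx => hKR x (hZΩ hx) hx.1
  have hFZ : ∀ x ∉ Z, F x = 0 := fun x hx => by
    by_contra h; exact hx (h0 x h)
  have hc : HasCompactSupport F := HasCompactSupport.intro' (hK.of_isClosed_subset hZ hZK) hZ hFZ
  have hD : ∀ x ∉ Z, partialD j F x = 0 := fun x hx => by
    have : F =ᶠ[𝓝 x] fun _ => 0 := by
      filter_upwards [hZ.isOpen_compl.mem_nhds hx] with y hy using hFZ y hy
    rw [partialD_congr this]
    fin_cases j <;> simp [partialD]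
  have hDc : Continuous (partialD j F) := continuous_partialD hF j
  refine ⟨(hDc.integrable_of_hasCompactSupport
    (HasCompactSupport.intro' (hK.of_isClosed_subset hZ hZK) hZ hD)).integrableOn, ?_⟩
  rw [setIntegral_eq_integral_of_forall_compl_eq_zero fun x hx => hD x fun h => hx (hZΩ h)]
  exact integral_partialD_eq_zero hF hc j

/-! ### The trilinear form up to a divergence -/

/-- The component of `u` along `(1, f₂')`, tangential to the translates of the upper wall. -/
noncomputable def tangentComponent (Ω : Channel) (u : Fin 2 → ℝ × ℝ → ℝ) (x : ℝ × ℝ) : ℝ :=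
  u 0 x + deriv Ω.f₂ x.1 * u 1 x

/-- The vertical derivative of `tangentComponent`. -/
noncomputable def tangentComponentDeriv (Ω : Channel) (u : Fin 2 → ℝ × ℝ → ℝ) (x : ℝ × ℝ) : ℝ :=
  partialD 1 (u 0) x + deriv Ω.f₂ x.1 * partialD 1 (u 1) x

/-- The first component of a vector field whose divergence contains the critical part of the
trilinear form. -/
noncomputable def criticalFst (Ω : Channel) (m p : ℝ → ℝ) (u : Fin 2 → ℝ × ℝ → ℝ)
    (x : ℝ × ℝ) : ℝ :=
  -(1 / 2) * ((1 - p x.1) * deriv m (Ω.f₂ x.1 - x.2) * (1 + deriv Ω.f₂ x.1 ^ 2) * u 0 x ^ 2)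

/-- The second component of a vector field whose divergence contains the critical part of the
trilinear form. -/
noncomputable def criticalSnd (Ω : Channel) (m p : ℝ → ℝ) (u : Fin 2 → ℝ × ℝ → ℝ)
    (x : ℝ × ℝ) : ℝ :=
  criticalFst Ω m p u x * deriv Ω.f₂ x.1 -
    (1 - p x.1) * deriv m (Ω.f₂ x.1 - x.2) * crossComponent Ω u x * tangentComponent Ω u x

/-- The part of the trilinear form controlled by Hardy's inequality. -/
noncomputable def wallPart (Ω : Channel) (m p : ℝ → ℝ) (u : Fin 2 → ℝ × ℝ → ℝ)
    (x : ℝ × ℝ) : ℝ :=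
  (1 - p x.1) * deriv m (Ω.f₂ x.1 - x.2) * crossComponent Ω u x *
    (tangentComponentDeriv Ω u x + deriv Ω.f₂ x.1 * crossComponentDeriv Ω u x -
      deriv (deriv Ω.f₂) x.1 * u 0 x)

/-- The part of the trilinear form containing derivatives of the horizontal cut-off. -/
noncomputable def cutoffPart (Ω : Channel) (m p : ℝ → ℝ) (u : Fin 2 → ℝ × ℝ → ℝ)
    (x : ℝ × ℝ) : ℝ :=
  1 / 2 * deriv p x.1 * (1 + deriv m (Ω.f₂ x.1 - x.2)) * u 0 x ^ 2 -
    deriv p x.1 * (deriv m (Ω.f₂ x.1 - x.2) + 1 / 2) * u 1 x ^ 2 +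
    deriv (deriv p) x.1 * (m (Ω.f₂ x.1 - x.2) - (x.2 + 1) / 2) * (u 0 x * u 1 x)

section carrier

variable {Ω : Channel} {c : CutoffFamily} {m : ℝ → ℝ} {ε η d : ℝ} {u : Fin 2 → ℝ × ℝ → ℝ}

theorem partialD_unitCarrier (hm : IsProfile m ε η) (hd : 0 < d) (x : ℝ × ℝ) :
    partialD 0 (unitCarrier Ω m (c.pi d) 0) x =
      deriv (c.pi d) x.1 * deriv m (Ω.f₂ x.1 - x.2) -
      (1 - c.pi d x.1) * (deriv (deriv m) (Ω.f₂ x.1 - x.2) * deriv Ω.f₂ x.1) +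
      deriv (c.pi d) x.1 / 2 ∧
    partialD 1 (unitCarrier Ω m (c.pi d) 0) x =
      (1 - c.pi d x.1) * deriv (deriv m) (Ω.f₂ x.1 - x.2) ∧
    partialD 0 (unitCarrier Ω m (c.pi d) 1) x =
      -(deriv (deriv m) (Ω.f₂ x.1 - x.2) * deriv Ω.f₂ x.1 * deriv Ω.f₂ x.1 +
        deriv m (Ω.f₂ x.1 - x.2) * deriv (deriv Ω.f₂) x.1) +
      (deriv (deriv (c.pi d)) x.1 * (m (Ω.f₂ x.1 - x.2) - (x.2 + 1) / 2) +
        deriv (c.pi d) x.1 * (deriv m (Ω.f₂ x.1 - x.2) * deriv Ω.f₂ x.1)) ∧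
    partialD 1 (unitCarrier Ω m (c.pi d) 1) x =
      deriv (deriv m) (Ω.f₂ x.1 - x.2) * deriv Ω.f₂ x.1 +
      deriv (c.pi d) x.1 * (-deriv m (Ω.f₂ x.1 - x.2) - 1 / 2) := by
  obtain ⟨t, y⟩ := x
  have a0 := hasDerivAt_comp_depth_fst (Ω := Ω) hm.hasDerivAt t y
  have a1 := hasDerivAt_comp_depth_snd (Ω := Ω) hm.hasDerivAt t y
  have b0 := hasDerivAt_comp_depth_fst (Ω := Ω) hm.hasDerivAt_deriv t y
  have b1 := hasDerivAt_comp_depth_snd (Ω := Ω) hm.hasDerivAt_deriv t y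
  have p0 := c.hasDerivAt_pi hd t
  have p1 := c.hasDerivAt_deriv_pi hd t
  have y1 : HasDerivAt (fun y : ℝ => (y + 1) / 2) (1 / 2) y :=
    ((hasDerivAt_id y).add_const 1).div_const 2
  refine ⟨HasDerivAt.deriv ?_, HasDerivAt.deriv ?_, HasDerivAt.deriv ?_, HasDerivAt.deriv ?_⟩
  · exact ((((p0.const_sub 1).mul b0).neg).add (p0.div_const 2)).congr_deriv (by ring)
  · exact (((b1.const_mul (1 - c.pi d t)).neg).add_const (c.pi d t / 2)).congr_deriv (by ring)
  · exact ((b0.mul (Ω.hasDerivAt_deriv₂ t)).neg).add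
      (p1.mul (a0.sub_const ((y + 1) / 2)))
  · exact (((b1.mul_const (deriv Ω.f₂ t)).neg).add
      ((a1.sub y1).const_mul (deriv (c.pi d) t))).congr_deriv (by ring)

theorem smooth_criticalFst (hm : IsProfile m ε η) (hd : 0 < d) (hu : IsSmoothSolenoidal Ω u) :
    ContDiff ℝ ∞ (criticalFst Ω m (c.pi d) u) := by
  have h2 := hm.smooth_deriv
  have h3 := c.pi_smooth d hd
  have h5 := Ω.smooth₂
  have h6 := Ω.smooth_deriv₂
  have h7 := hu.smooth 0
  unfold criticalFst
  fun_prop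

theorem smooth_criticalSnd (hm : IsProfile m ε η) (hd : 0 < d) (hu : IsSmoothSolenoidal Ω u) :
    ContDiff ℝ ∞ (criticalSnd Ω m (c.pi d) u) := by
  have h1 := smooth_criticalFst (c := c) hm hd hu
  have h2 := hm.smooth_deriv
  have h3 := c.pi_smooth d hd
  have h5 := Ω.smooth₂
  have h6 := Ω.smooth_deriv₂
  have h7 := hu.smooth 0
  have h8 := hu.smooth 1
  unfold criticalSnd crossComponent tangentComponent
  fun_prop

/-- This is where the second derivative of the profile disappears. The term `-k w q` in
`criticalSnd` moves one derivative off it. The field `criticalFst · (1, f₂')` then absorbs `k q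
∂₂w`, because `div u = 0` turns `∂₂w` into a derivative of `u₁` along the translated walls.
Differentiating `1 + f₂'²` and the factor `f₂'` in the carrier leaves terms that combine to `-k f₂''
u₁ w`, which again contains `w`. -/
theorem trilinear_unitCarrier_eq (hm : IsProfile m ε η) (hd : Ω.L < d)
    (hu : IsSmoothSolenoidal Ω u) {x : ℝ × ℝ} (hx : x ∈ Ω.domain) :
    trilinear u (unitCarrier Ω m (c.pi d)) x =
      partialD 0 (criticalFst Ω m (c.pi d) u) x + partialD 1 (criticalSnd Ω m (c.pi d) u) x +
      (wallPart Ω m (c.pi d) u x + cutoffPart Ω m (c.pi d) u x) := by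
  have hd0 : 0 < d := Ω.L_pos.trans hd
  obtain ⟨e00, e01, e10, e11⟩ := partialD_unitCarrier (Ω := Ω) (c := c) hm hd0 x
  have hdiv := hu.div_eq_zero x hx
  rw [Fin.sum_univ_two] at hdiv
  have hcase := c.inactive_or_flat hd x.1
  simp only [trilinear, Fin.sum_univ_two, e00, e01, e10, e11]
  obtain ⟨t, y⟩ := x
  have b0 := hasDerivAt_comp_depth_fst (Ω := Ω) hm.hasDerivAt_deriv t y
  have b1 := hasDerivAt_comp_depth_snd (Ω := Ω) hm.hasDerivAt_deriv t y
  have p0 := c.hasDerivAt_pi hd0 t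
  have β0 := Ω.hasDerivAt_deriv₂ t
  have u00 := hasDerivAt_partialD_zero (hu.differentiable 0) t y
  have u01 := hasDerivAt_partialD_one (hu.differentiable 0) t y
  have u11 := hasDerivAt_partialD_one (hu.differentiable 1) t y
  have F0 : partialD 0 (criticalFst Ω m (c.pi d) u) (t, y) = _ := HasDerivAt.deriv
    ((((((p0.const_sub 1).mul b0).mul ((β0.pow 2).const_add 1)).mul (u00.pow 2)).const_mul
      (-(1 / 2))))
  have w1 := hu.hasDerivAt_crossComponent t y
  have q1 : HasDerivAt (fun y => tangentComponent Ω u (t, y)) (tangentComponentDeriv Ω u (t, y)) y :=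
    u01.add (u11.const_mul (deriv Ω.f₂ t))
  have F1 : partialD 1 (criticalSnd Ω m (c.pi d) u) (t, y) = _ := HasDerivAt.deriv
    (((((((b1.const_mul (1 - c.pi d t)).mul_const (1 + deriv Ω.f₂ t ^ 2)).mul
      (u01.pow 2)).const_mul (-(1 / 2))).mul_const (deriv Ω.f₂ t)).sub
      (((b1.const_mul (1 - c.pi d t)).mul w1).mul q1)))
  rw [F0, F1]
  simp only [wallPart, cutoffPart, crossComponent, crossComponentDeriv, tangentComponent,
    tangentComponentDeriv, Pi.mul_apply, Pi.pow_apply, Nat.cast_ofNat, Nat.add_one_sub_one, pow_one]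
  simp only at hcase hdiv
  have hdiv' : partialD 0 (u 0) (t, y) = -partialD 1 (u 1) (t, y) := by linarith
  rw [hdiv']
  -- The identity drops all products of `f₂'` or `f₂''` with `π`, `π'` or `π''`; these vanish in
  -- either case.
  rcases hcase with ⟨h1, h2, h3⟩ | ⟨h1, h2⟩
  · rw [h1, h2, h3]; ring
  · rw [h1, h2]; ring

end carrier

end SlipChannel

namespace SlipChannel

/-! ### Bounds for the wall and cut-off parts -/

section estimates

variable {Ω : Channel} {c : CutoffFamily} {m : ℝ → ℝ} {ε η d : ℝ} {u : Fin 2 → ℝ × ℝ → ℝ}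

theorem tangentComponentDeriv_sq_le {M : ℝ} {x : ℝ × ℝ} (hM : |deriv Ω.f₂ x.1| ≤ M) :
    tangentComponentDeriv Ω u x ^ 2 ≤ 2 * (1 + M ^ 2) * gradSq u x := by
  have h1 : deriv Ω.f₂ x.1 ^ 2 ≤ M ^ 2 := sq_le_sq' (by linarith [(abs_le.1 hM).1]) (abs_le.1 hM).2
  simp only [tangentComponentDeriv, gradSq, Fin.sum_univ_two]
  set a := partialD 1 (u 1) x
  set b := partialD 1 (u 0) x
  set β := deriv Ω.f₂ x.1
  have h2 : (b + β * a) ^ 2 ≤ 2 * b ^ 2 + 2 * (β ^ 2 * a ^ 2) := by nlinarith [sq_nonneg (b - β * a)]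
  have h3 : β ^ 2 * a ^ 2 ≤ M ^ 2 * a ^ 2 := by gcongr
  nlinarith [sq_nonneg a, sq_nonneg b, mul_nonneg (sq_nonneg M) (sq_nonneg b),
    mul_nonneg (sq_nonneg M) (sq_nonneg (partialD 0 (u 0) x)),
    mul_nonneg (sq_nonneg M) (sq_nonneg (partialD 0 (u 1) x)),
    sq_nonneg (partialD 0 (u 0) x), sq_nonneg (partialD 0 (u 1) x)]

/-- The slope bound `2ε / (s + η)` contributes the small factor and the Hardy weight at once; `2ab ≤
a² + b²` then separates `w / (s + η)` from the first-order factor. -/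
theorem abs_wallPart_le (hm : IsProfile m ε η) (hε : 0 < ε) (hd : 0 < d) {M : ℝ} {x : ℝ × ℝ}
    (hx : x ∈ Ω.domain) (h1 : |deriv Ω.f₂ x.1| ≤ M) (h2 : |deriv (deriv Ω.f₂) x.1| ≤ M) :
    |wallPart Ω m (c.pi d) u x| ≤
      ε * (crossComponent Ω u x ^ 2 / (Ω.f₂ x.1 - x.2 + η) ^ 2 +
        (6 * (1 + M ^ 2) ^ 2 * gradSq u x + 3 * M ^ 2 * u 0 x ^ 2)) := by
  have hs : 0 < Ω.f₂ x.1 - x.2 := sub_pos.2 hx.2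
  have hη := hm.pos
  set ρ := Ω.f₂ x.1 - x.2 + η with hρ
  have hρ0 : 0 < ρ := by linarith
  set w := crossComponent Ω u x
  set X := tangentComponentDeriv Ω u x + deriv Ω.f₂ x.1 * crossComponentDeriv Ω u x -
      deriv (deriv Ω.f₂) x.1 * u 0 x with hX
  have hp := c.pi_mem d hd x.1
  have hk : |(1 - c.pi d x.1) * deriv m (Ω.f₂ x.1 - x.2)| ≤ 2 * ε / ρ := by
    rw [abs_mul, abs_of_nonneg (by linarith [hp.2])]
    calc _ ≤ 1 * |deriv m (Ω.f₂ x.1 - x.2)| := by gcongr; linarith [hp.1]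
      _ ≤ 2 * ε / ρ := by rw [one_mul]; exact hm.abs_deriv_le_shifted hε hs
  have hX2 : X ^ 2 ≤ 6 * (1 + M ^ 2) ^ 2 * gradSq u x + 3 * M ^ 2 * u 0 x ^ 2 := by
    have e1 := tangentComponentDeriv_sq_le (u := u) h1
    have e2 := crossComponentDeriv_sq_le (u := u) h1
    have e3 : deriv Ω.f₂ x.1 ^ 2 ≤ M ^ 2 :=
      sq_le_sq' (by linarith [(abs_le.1 h1).1]) (abs_le.1 h1).2
    have e4 : deriv (deriv Ω.f₂) x.1 ^ 2 ≤ M ^ 2 :=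
      sq_le_sq' (by linarith [(abs_le.1 h2).1]) (abs_le.1 h2).2
    have e5 : (deriv Ω.f₂ x.1 * crossComponentDeriv Ω u x) ^ 2 ≤
        M ^ 2 * (2 * (1 + M ^ 2) * gradSq u x) := by
      rw [mul_pow]; gcongr
    have e6 : (deriv (deriv Ω.f₂) x.1 * u 0 x) ^ 2 ≤ M ^ 2 * u 0 x ^ 2 := by
      rw [mul_pow]; gcongr
    have e7 : ∀ a b e : ℝ, (a + b - e) ^ 2 ≤ 3 * (a ^ 2 + b ^ 2 + e ^ 2) := fun a b e => by
      nlinarith [sq_nonneg (a - b), sq_nonneg (a + e), sq_nonneg (b + e)]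
    have e8 := e7 (tangentComponentDeriv Ω u x) (deriv Ω.f₂ x.1 * crossComponentDeriv Ω u x)
      (deriv (deriv Ω.f₂) x.1 * u 0 x)
    linarith
  have hAG : 2 * (|w| / ρ) * |X| ≤ w ^ 2 / ρ ^ 2 + X ^ 2 := by
    have := two_mul_le_add_sq (|w| / ρ) |X|
    rwa [div_pow, sq_abs, sq_abs] at this
  calc |wallPart Ω m (c.pi d) u x|
      = |(1 - c.pi d x.1) * deriv m (Ω.f₂ x.1 - x.2)| * |w| * |X| := by
        rw [wallPart, abs_mul, abs_mul]
    _ ≤ 2 * ε / ρ * |w| * |X| := by gcongr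
    _ = ε * (2 * (|w| / ρ) * |X|) := by ring
    _ ≤ ε * (w ^ 2 / ρ ^ 2 + X ^ 2) := by gcongr
    _ ≤ _ := by gcongr

theorem abs_cutoffPart_le (hm : IsProfile m ε η) (hε : 0 < ε) (hd : 1 ≤ d) {M : ℝ} (hM : 1 ≤ M)
    {x : ℝ × ℝ} (hx : |x.2| ≤ M) :
    |cutoffPart Ω m (c.pi d) u x| ≤
      (4 * (ε / η) + 2 + |c.K| * (1 + M)) / d * (u 0 x ^ 2 + u 1 x ^ 2) := by
  have hd0 : 0 < d := by linarith
  have hη := hm.pos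
  set N := ε / η with hN
  have hN0 : 0 < N := div_pos hε hη
  have k1 := c.pi_deriv d hd0 x.1
  -- For `d ≥ 1` the decay `1/d²` is weakened to `1/d`, so that all terms share one rate.
  have k2 : |deriv (deriv (c.pi d)) x.1| ≤ |c.K| / d := by
    refine (c.pi_deriv2 d hd0 x.1).trans ?_
    calc c.K / d ^ 2 ≤ |c.K| / d ^ 2 := by gcongr; exact le_abs_self _
      _ ≤ |c.K| / d := by gcongr; nlinarith
  have k3 : |deriv m (Ω.f₂ x.1 - x.2)| ≤ N := hm.abs_deriv_le_bound hε _
  have k4 : |m (Ω.f₂ x.1 - x.2) - (x.2 + 1) / 2| ≤ 1 + M := by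
    have h1 := hm.mem (Ω.f₂ x.1 - x.2)
    have h2 := abs_le.1 hx
    rw [abs_le]
    constructor <;> linarith [h1.1, h1.2, h2.1, h2.2]
  unfold cutoffPart
  set p' := deriv (c.pi d) x.1
  set p'' := deriv (deriv (c.pi d)) x.1
  set m' := deriv m (Ω.f₂ x.1 - x.2)
  set Y := m (Ω.f₂ x.1 - x.2) - (x.2 + 1) / 2
  set a := u 0 x
  set b := u 1 x
  have t1 : |1 / 2 * p' * (1 + m') * a ^ 2| ≤ 1 / 2 * (4 / d) * (1 + N) * a ^ 2 := by
    rw [abs_mul, abs_mul, abs_mul, abs_of_nonneg (sq_nonneg a), abs_of_pos (one_half_pos (α := ℝ))]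
    gcongr
    exact (abs_add_le _ _).trans (by rw [abs_one]; gcongr)
  have t2 : |p' * (m' + 1 / 2) * b ^ 2| ≤ 4 / d * (N + 1 / 2) * b ^ 2 := by
    rw [abs_mul, abs_mul, abs_of_nonneg (sq_nonneg b)]
    gcongr
    exact (abs_add_le _ _).trans (by rw [abs_of_pos (one_half_pos (α := ℝ))]; gcongr)
  have t3 : |p'' * Y * (a * b)| ≤ |c.K| / d * (1 + M) * (a ^ 2 + b ^ 2) := by
    rw [abs_mul, abs_mul]
    have : |a * b| ≤ a ^ 2 + b ^ 2 := by
      rw [abs_le]; constructor <;> nlinarith [sq_nonneg (a + b), sq_nonneg (a - b)]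
    gcongr
  calc _ ≤ |1 / 2 * p' * (1 + m') * a ^ 2| + |p' * (m' + 1 / 2) * b ^ 2| + |p'' * Y * (a * b)| :=
        (abs_add_le _ _).trans (add_le_add (abs_sub _ _) le_rfl)
    _ ≤ 1 / 2 * (4 / d) * (1 + N) * a ^ 2 + 4 / d * (N + 1 / 2) * b ^ 2 +
        |c.K| / d * (1 + M) * (a ^ 2 + b ^ 2) := by gcongr
    _ ≤ _ := by
      have h1 : 0 ≤ N / d * a ^ 2 := by positivity
      have h2 : (4 * N + 2 + |c.K| * (1 + M)) / d * (a ^ 2 + b ^ 2) -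
          (1 / 2 * (4 / d) * (1 + N) * a ^ 2 + 4 / d * (N + 1 / 2) * b ^ 2 +
          |c.K| / d * (1 + M) * (a ^ 2 + b ^ 2)) = 2 * (N / d * a ^ 2) := by ring
      linarith

/-- Both components carry the factor `(1 - π) m'(f₂ - x₂)`, which alone determines where they can be
nonzero. -/
theorem critical_ne_zero (hm : IsProfile m ε η) (hd : 0 < d) {x : ℝ × ℝ}
    (h : criticalFst Ω m (c.pi d) u x ≠ 0 ∨ criticalSnd Ω m (c.pi d) u x ≠ 0) :
    |x.1| ≤ 7 * d / 4 ∧ η ≤ Ω.f₂ x.1 - x.2 ∧ Ω.f₂ x.1 - x.2 ≤ ε := by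
  by_contra hcon
  have hk : (1 - c.pi d x.1) * deriv m (Ω.f₂ x.1 - x.2) = 0 := by
    by_cases h1 : |x.1| ≤ 7 * d / 4
    · by_cases h2 : η ≤ Ω.f₂ x.1 - x.2
      · rw [hm.deriv_right _ (not_le.1 fun h3 => hcon ⟨h1, h2, h3⟩), mul_zero]
      · rw [hm.deriv_left _ (not_le.1 h2), mul_zero]
    · rw [c.pi_eq_one d hd _ (not_le.1 h1).le, sub_self, zero_mul]
  simp [criticalSnd, criticalFst, hk] at h

theorem exists_bound_partialD_unitCarrier (hm : IsProfile m ε η) (hd : Ω.L < d) (i j : Fin 2) :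
    ∃ B, ∀ x ∈ Ω.domain, |partialD j (unitCarrier Ω m (c.pi d) i) x| ≤ B :=
  Ω.exists_bound_of_continuous
    (continuous_partialD (smooth_unitCarrier hm (Ω.L_pos.trans hd) i) j)
    fun _ hx => partialD_unitCarrier_eq_zero hd i j hx

theorem memLp_partialD_unitCarrier_mul (hm : IsProfile m ε η) (hd : Ω.L < d) (i j : Fin 2)
    {f : ℝ × ℝ → ℝ} (hf : MemLp f 2 (volume.restrict Ω.domain)) :
    MemLp (fun x => partialD j (unitCarrier Ω m (c.pi d) i) x * f x) 2
      (volume.restrict Ω.domain) := by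
  obtain ⟨B, hB⟩ := exists_bound_partialD_unitCarrier (c := c) hm hd i j
  exact memLp_bdd_mul (continuous_partialD
    (smooth_unitCarrier hm (Ω.L_pos.trans hd) i) j).aestronglyMeasurable hB hf

theorem integrableOn_trilinear_term (hm : IsProfile m ε η) (hd : Ω.L < d)
    {v : Fin 2 → ℝ × ℝ → ℝ} (hv : ∀ i, MemLp (v i) 2 (volume.restrict Ω.domain)) (i j : Fin 2) :
    IntegrableOn (fun x => v j x * partialD j (unitCarrier Ω m (c.pi d) i) x * v i x)
      Ω.domain := by
  have h : IntegrableOn (fun x => v j x * (partialD j (unitCarrier Ω m (c.pi d) i) x * v i x))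
      Ω.domain := (hv j).integrable_mul (memLp_partialD_unitCarrier_mul hm hd i j (hv i))
  simpa only [mul_assoc] using h

theorem integrableOn_trilinear_unitCarrier (hm : IsProfile m ε η) (hd : Ω.L < d)
    {v : Fin 2 → ℝ × ℝ → ℝ} (hv : ∀ i, MemLp (v i) 2 (volume.restrict Ω.domain)) :
    IntegrableOn (trilinear v (unitCarrier Ω m (c.pi d))) Ω.domain :=
  integrable_finsetSum _ fun i _ => integrable_finsetSum _ fun j _ =>
    integrableOn_trilinear_term hm hd hv i j

theorem abs_integral_trilinear_unitCarrier_le (hm : IsProfile m ε η) (hε : 0 < ε)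
    (hgap : ∀ t, ε < Ω.f₂ t - Ω.f₁ t) (hd : Ω.L < d) (hd1 : 1 ≤ d)
    (hu : IsSmoothSolenoidal Ω u) {M P : ℝ} (hM : 1 ≤ M)
    (hb : ∀ t, |Ω.f₁ t| ≤ M ∧ |Ω.f₂ t| ≤ M ∧
      Ω.f₂ t - Ω.f₁ t ≤ M ∧ |deriv Ω.f₂ t| ≤ M ∧ |deriv (deriv Ω.f₂) t| ≤ M)
    (hP : ∫ x in Ω.domain, (u 0 x ^ 2 + u 1 x ^ 2) ≤ P * ∫ x in Ω.domain, gradSq u x) :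
    |∫ x in Ω.domain, trilinear u (unitCarrier Ω m (c.pi d)) x| ≤
      ((8 * (1 + M ^ 2) + 6 * (1 + M ^ 2) ^ 2 + 3 * M ^ 2 * P) * ε +
        (4 * (ε / η) + 2 + |c.K| * (1 + M)) * P / d) * ∫ x in Ω.domain, gradSq u x := by
  have hd0 : 0 < d := by linarith
  have hη := hm.pos
  obtain ⟨i0, z0⟩ := Ω.setIntegral_partialD_eq_zero (smooth_criticalFst (c := c) hm hd0 hu)
    hm.pos hgap (fun x hx => critical_ne_zero hm hd0 (Or.inl hx)) 0
  obtain ⟨i1, z1⟩ := Ω.setIntegral_partialD_eq_zero (smooth_criticalSnd (c := c) hm hd0 hu)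
    hm.pos hgap (fun x hx => critical_ne_zero hm hd0 (Or.inr hx)) 1
  have iT := integrableOn_trilinear_unitCarrier (c := c) hm hd hu.memLp
  let D : ℝ × ℝ → ℝ := fun x => partialD 0 (criticalFst Ω m (c.pi d) u) x +
    partialD 1 (criticalSnd Ω m (c.pi d) u) x
  have iD : IntegrableOn D Ω.domain := i0.add i1
  have zD : ∫ x in Ω.domain, D x = 0 := by
    rw [integral_add i0 i1, z0, z1, add_zero]
  -- Absolute values may be taken only after the divergence `D`, which still contains the second
  -- derivative of the profile, has been subtracted.
  have hT : ∫ x in Ω.domain, trilinear u (unitCarrier Ω m (c.pi d)) x =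
      ∫ x in Ω.domain, (trilinear u (unitCarrier Ω m (c.pi d)) x - D x) := by
    rw [integral_sub iT iD, zD, sub_zero]
  set C := 4 * (ε / η) + 2 + |c.K| * (1 + M) with hC
  have hC0 : 0 ≤ C := by positivity
  have iH := hu.integrable_hardy hη
  have iG := hu.integrable_gradSq
  have iu : IntegrableOn (fun x => u 0 x ^ 2 + u 1 x ^ 2) Ω.domain :=
    (hu.memLp 0).integrable_sq.add (hu.memLp 1).integrable_sq
  have iR : IntegrableOn (fun x => 6 * (1 + M ^ 2) ^ 2 * gradSq u x +
      3 * M ^ 2 * (u 0 x ^ 2 + u 1 x ^ 2)) Ω.domain := (iG.const_mul _).add (iu.const_mul _)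
  have iW : IntegrableOn (fun x => ε * (crossComponent Ω u x ^ 2 / (Ω.f₂ x.1 - x.2 + η) ^ 2 +
      (6 * (1 + M ^ 2) ^ 2 * gradSq u x + 3 * M ^ 2 * (u 0 x ^ 2 + u 1 x ^ 2)))) Ω.domain :=
    (iH.add iR).const_mul ε
  have iC : IntegrableOn (fun x => C / d * (u 0 x ^ 2 + u 1 x ^ 2)) Ω.domain := iu.const_mul _
  have hbound : |∫ x in Ω.domain, (trilinear u (unitCarrier Ω m (c.pi d)) x - D x)| ≤
      ∫ x in Ω.domain, (ε * (crossComponent Ω u x ^ 2 / (Ω.f₂ x.1 - x.2 + η) ^ 2 +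
        (6 * (1 + M ^ 2) ^ 2 * gradSq u x + 3 * M ^ 2 * (u 0 x ^ 2 + u 1 x ^ 2))) +
        C / d * (u 0 x ^ 2 + u 1 x ^ 2)) := by
    rw [← Real.norm_eq_abs]
    refine norm_integral_le_of_norm_le (iW.add iC) ?_
    filter_upwards [ae_restrict_mem Ω.measurableSet_domain] with x hx
    rw [trilinear_unitCarrier_eq hm hd hu hx, add_sub_cancel_left, Real.norm_eq_abs]
    have hy : |x.2| ≤ M := abs_le.2
      ⟨by linarith [hx.1, (abs_le.1 (hb x.1).1).1], by linarith [hx.2, (abs_le.1 (hb x.1).2.1).2]⟩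
    have e1 := abs_wallPart_le (c := c) (u := u) hm hε hd0 hx (hb x.1).2.2.2.1 (hb x.1).2.2.2.2
    have e2 := abs_cutoffPart_le (Ω := Ω) (c := c) (u := u) hm hε hd1 hM hy
    refine (abs_add_le _ _).trans (add_le_add (e1.trans ?_) e2)
    gcongr
    linarith [sq_nonneg (u 1 x)]
  rw [hT]
  refine hbound.trans ?_
  rw [integral_add iW iC, integral_const_mul, integral_const_mul, integral_add iH iR,
    integral_add (iG.const_mul _) (iu.const_mul _), integral_const_mul, integral_const_mul]
  have hH := hu.hardy (fun t => (hb t).2.2.2.1) hη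
  set I := ∫ x in Ω.domain, gradSq u x
  calc _ ≤ ε * (8 * (1 + M ^ 2) * I + (6 * (1 + M ^ 2) ^ 2 * I + 3 * M ^ 2 * (P * I))) +
        C / d * (P * I) := by gcongr
    _ = _ := by ring

end estimates

/-! ### Passage to the limit -/

/-- The integral is an inner product in `L²`, which is jointly continuous. -/
theorem tendsto_integral_mul {α : Type*} [MeasurableSpace α] {μ : Measure α} {f g : ℕ → α → ℝ}
    {f' g' : α → ℝ} (hf : ∀ n, MemLp (f n) 2 μ) (hg : ∀ n, MemLp (g n) 2 μ) (hf' : MemLp f' 2 μ)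
    (hg' : MemLp g' 2 μ) (hlf : Tendsto (fun n => eLpNorm (f n - f') 2 μ) atTop (𝓝 0))
    (hlg : Tendsto (fun n => eLpNorm (g n - g') 2 μ) atTop (𝓝 0)) :
    Tendsto (fun n => ∫ x, f n x * g n x ∂μ) atTop (𝓝 (∫ x, f' x * g' x ∂μ)) := by
  have h1 := (Lp.tendsto_Lp_iff_tendsto_eLpNorm'' f hf f' hf').2 hlf
  have h2 := (Lp.tendsto_Lp_iff_tendsto_eLpNorm'' g hg g' hg').2 hlg
  have key : ∀ {a b : α → ℝ} (ha : MemLp a 2 μ) (hb : MemLp b 2 μ),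
      inner ℝ (hb.toLp b) (ha.toLp a) = ∫ x, a x * b x ∂μ := fun ha hb => by
    rw [L2.inner_def]
    refine integral_congr_ae ?_
    filter_upwards [ha.coeFn_toLp, hb.coeFn_toLp] with x h1 h2
    rw [h1, h2]; rfl
  have h := h2.inner (𝕜 := ℝ) h1
  simpa only [key] using h

theorem tendsto_eLpNorm_bdd_mul {Ω : Channel} {b : ℝ × ℝ → ℝ} {B : ℝ}
    (hB : ∀ x ∈ Ω.domain, |b x| ≤ B) {f : ℕ → ℝ × ℝ → ℝ} {f' : ℝ × ℝ → ℝ}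
    (h : Tendsto (fun n => eLpNorm (f n - f') 2 (volume.restrict Ω.domain)) atTop (𝓝 0)) :
    Tendsto (fun n => eLpNorm ((fun x => b x * f n x) - fun x => b x * f' x) 2
      (volume.restrict Ω.domain)) atTop (𝓝 0) := by
  have h0 : Tendsto (fun n => ENNReal.ofReal B * eLpNorm (f n - f') 2 (volume.restrict Ω.domain))
      atTop (𝓝 0) := by
    simpa using ENNReal.Tendsto.const_mul h (Or.inr ENNReal.ofReal_ne_top)
  refine tendsto_of_tendsto_of_tendsto_of_le_of_le tendsto_const_nhds h0 (fun _ => zero_le) fun n => ?_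
  refine eLpNorm_le_mul_eLpNorm_of_ae_le_mul ?_ 2
  filter_upwards [ae_restrict_mem Ω.measurableSet_domain] with x hx
  simp only [Pi.sub_apply, ← mul_sub, norm_mul]
  exact mul_le_mul_of_nonneg_right (hB x hx) (norm_nonneg _)

/-- For a fixed carrier the coefficients `∂ⱼhᵢ` are bounded, so both sides are continuous under `L²`
convergence of the fields and of their gradients. -/
theorem MemHσ.abs_integral_trilinear_unitCarrier_le {Ω : Channel} {c : CutoffFamily} {m : ℝ → ℝ}
    {ε η d k : ℝ} {v : Fin 2 → ℝ × ℝ → ℝ} {A : Fin 2 → Fin 2 → ℝ × ℝ → ℝ} (hv : MemHσ Ω v A)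
    (hm : IsProfile m ε η) (hd : Ω.L < d)
    (hk : ∀ u, IsSmoothSolenoidal Ω u →
      |∫ x in Ω.domain, trilinear u (unitCarrier Ω m (c.pi d)) x| ≤
        k * ∫ x in Ω.domain, gradSq u x) :
    |∫ x in Ω.domain, trilinear v (unitCarrier Ω m (c.pi d)) x| ≤
      k * ∫ x in Ω.domain, ∑ i, ∑ j, A i j x ^ 2 := by
  obtain ⟨u, hu, hl, hlA⟩ := hv.approx
  have hterm : ∀ i j, Tendsto (fun n => ∫ x in Ω.domain,
      u n j x * partialD j (unitCarrier Ω m (c.pi d) i) x * u n i x) atTop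
      (𝓝 (∫ x in Ω.domain, v j x * partialD j (unitCarrier Ω m (c.pi d) i) x * v i x)) := by
    intro i j
    obtain ⟨B, hB⟩ := exists_bound_partialD_unitCarrier (c := c) hm hd i j
    simp only [mul_assoc]
    exact tendsto_integral_mul (fun n => (hu n).memLp j)
      (fun n => memLp_partialD_unitCarrier_mul hm hd i j ((hu n).memLp i)) (hv.memLp j)
      (memLp_partialD_unitCarrier_mul hm hd i j (hv.memLp i)) (hl j)
      (tendsto_eLpNorm_bdd_mul hB (hl i))
  have hsplit : ∀ w : Fin 2 → ℝ × ℝ → ℝ, (∀ i, MemLp (w i) 2 (volume.restrict Ω.domain)) →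
      ∫ x in Ω.domain, trilinear w (unitCarrier Ω m (c.pi d)) x = ∑ i, ∑ j, ∫ x in Ω.domain,
        w j x * partialD j (unitCarrier Ω m (c.pi d) i) x * w i x := fun w hw => by
    simp only [trilinear]
    rw [integral_finsetSum _ fun i _ => integrable_finsetSum _ fun j _ =>
      integrableOn_trilinear_term hm hd hw i j]
    exact Finset.sum_congr rfl fun i _ =>
      integral_finsetSum _ fun j _ => integrableOn_trilinear_term hm hd hw i j
  have hgrad : ∀ W : Fin 2 → Fin 2 → ℝ × ℝ → ℝ,
      (∀ i j, MemLp (W i j) 2 (volume.restrict Ω.domain)) →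
      ∫ x in Ω.domain, ∑ i, ∑ j, W i j x ^ 2 = ∑ i, ∑ j, ∫ x in Ω.domain, W i j x * W i j x :=
    fun W hW => by
    rw [integral_finsetSum _ fun i _ => integrable_finsetSum _ fun j _ => (hW i j).integrable_sq]
    refine Finset.sum_congr rfl fun i _ => ?_
    rw [integral_finsetSum _ fun j _ => (hW i j).integrable_sq]
    simp only [sq]
  have hT : Tendsto (fun n => ∫ x in Ω.domain, trilinear (u n) (unitCarrier Ω m (c.pi d)) x) atTop
      (𝓝 (∫ x in Ω.domain, trilinear v (unitCarrier Ω m (c.pi d)) x)) := by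
    simp only [hsplit v hv.memLp, fun n => hsplit (u n) (hu n).memLp]
    exact tendsto_finsetSum _ fun i _ => tendsto_finsetSum _ fun j _ => hterm i j
  have hG : Tendsto (fun n => ∫ x in Ω.domain, gradSq (u n) x) atTop
      (𝓝 (∫ x in Ω.domain, ∑ i, ∑ j, A i j x ^ 2)) := by
    simp only [gradSq, hgrad A hv.memLp_grad,
      fun n => hgrad (fun i j => partialD j (u n i)) (hu n).memLp_grad]
    exact tendsto_finsetSum _ fun i _ => tendsto_finsetSum _ fun j _ =>
      tendsto_integral_mul (fun n => (hu n).memLp_grad i j) (fun n => (hu n).memLp_grad i j)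
        (hv.memLp_grad i j) (hv.memLp_grad i j) (hlA i j) (hlA i j)
  exact le_of_tendsto_of_tendsto' hT.abs (hG.const_mul k) fun n => hk (u n) (hu n)

/-! ### Choice of the parameters -/

theorem trilinear_carrier {Ω : Channel} {c : CutoffFamily} {m : ℝ → ℝ} {ε η d : ℝ}
    (hm : IsProfile m ε η) (hmu : ∀ t, 0 < t → m =ᶠ[𝓝 t] c.mu ε) (hd : Ω.L < d) (Φ : ℝ)
    (v : Fin 2 → ℝ × ℝ → ℝ) : EqOn (trilinear v (carrier Ω c Φ ε d))
      (fun x => Φ * trilinear v (unitCarrier Ω m (c.pi d)) x) Ω.domain := fun x hx => by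
  simp only [trilinear, Fin.sum_univ_two, partialD_carrier hm hmu hd Φ _ _ hx]
  ring

/-- The trilinear form with the flux carrier is small for a thin boundary layer and a distant
transition region. -/
theorem trilinear_estimate (Ω : Channel) (c : CutoffFamily) {Φ δ : ℝ} (hδ : 0 < δ) :
    ∃ ε₀ : ℝ, 0 < ε₀ ∧ ∀ ε : ℝ, 0 < ε → ε ≤ ε₀ →
      ∃ d₀ : ℝ, Ω.L < d₀ ∧ ∀ d : ℝ, d₀ ≤ d →
        ∀ (v : Fin 2 → ℝ × ℝ → ℝ) (A : Fin 2 → Fin 2 → ℝ × ℝ → ℝ), MemHσ Ω v A →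
          IntegrableOn (trilinear v (carrier Ω c Φ ε d)) Ω.domain ∧
          |∫ x in Ω.domain, trilinear v (carrier Ω c Φ ε d) x|
            ≤ δ * ∫ x in Ω.domain, ∑ i, ∑ j, A i j x ^ 2 := by
  obtain ⟨M, hM, hb⟩ := Ω.exists_bounds
  obtain ⟨w, hw, hgap⟩ := Ω.exists_width_lower_bound
  obtain ⟨P, hP, hpoin⟩ := exists_poincare Ω
  set Q := 8 * (1 + M ^ 2) + 6 * (1 + M ^ 2) ^ 2 + 3 * M ^ 2 * P with hQ
  have hQ0 : 0 < Q := by positivity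
  -- The first bound keeps the layer off the lower wall; the second makes the wall contribution at
  -- most `δ/2`. Using `|Φ| + 1` avoids dividing by zero when `Φ = 0`.
  refine ⟨min (w / 2) (δ / (2 * Q * (|Φ| + 1))), by positivity, fun ε hε hε₀ => ?_⟩
  obtain ⟨m, η, hm, hmu⟩ := c.exists_profile hε
  have hη := hm.pos
  set C := (4 * (ε / η) + 2 + |c.K| * (1 + M)) * P with hC
  have hC0 : 0 < C := by positivity
  -- The constant `C` involves `ε / η`, hence is known only after `ε` is fixed. The last summand
  -- brings the cut-off contribution down to `δ/2`, and `L + 1` ensures both `d > L` and `d ≥ 1`.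
  refine ⟨Ω.L + 1 + 2 * C * (|Φ| + 1) / δ,
    by have : 0 < 2 * C * (|Φ| + 1) / δ := by positivity
       linarith, fun d hd v A hv => ?_⟩
  have hL := Ω.L_pos
  have hd' : Ω.L + 1 ≤ d := by
    have : 0 < 2 * C * (|Φ| + 1) / δ := by positivity
    linarith
  have hdL : Ω.L < d := by linarith
  have hd0 : 0 < d := by linarith
  have heq := trilinear_carrier hm hmu hdL Φ v
  have iT := integrableOn_trilinear_unitCarrier (c := c) hm hdL hv.memLp
  refine ⟨IntegrableOn.congr_fun (iT.const_mul Φ) heq.symm Ω.measurableSet_domain, ?_⟩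
  rw [setIntegral_congr_fun Ω.measurableSet_domain heq, integral_const_mul, abs_mul]
  have hεw : ∀ t, ε < Ω.f₂ t - Ω.f₁ t := fun t => by
    linarith [hgap t, hε₀.trans (min_le_left _ _)]
  have h := hv.abs_integral_trilinear_unitCarrier_le (c := c) (k := Q * ε + C / d) hm hdL
    fun u hu => SlipChannel.abs_integral_trilinear_unitCarrier_le hm hε hεw hdL (by linarith) hu hM
      hb (hpoin u hu)
  have hI : 0 ≤ ∫ x in Ω.domain, ∑ i, ∑ j, A i j x ^ 2 := integral_nonneg fun x => by positivity
  have hQε : (|Φ| + 1) * (Q * ε) ≤ δ / 2 := by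
    have := hε₀.trans (min_le_right _ _)
    rw [le_div_iff₀ (by positivity)] at this
    linarith
  have hCd : (|Φ| + 1) * (C / d) ≤ δ / 2 := by
    have h1 : 2 * C * (|Φ| + 1) / δ ≤ d := by linarith
    rw [div_le_iff₀ hδ] at h1
    rw [← mul_div_assoc, div_le_iff₀ hd0]
    linarith
  calc _ ≤ (|Φ| + 1) * ((Q * ε + C / d) * ∫ x in Ω.domain, ∑ i, ∑ j, A i j x ^ 2) := by
        gcongr; linarith
    _ = ((|Φ| + 1) * (Q * ε) + (|Φ| + 1) * (C / d)) *
        ∫ x in Ω.domain, ∑ i, ∑ j, A i j x ^ 2 := by ring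
    _ ≤ δ * ∫ x in Ω.domain, ∑ i, ∑ j, A i j x ^ 2 := by gcongr; linarith

end SlipChannel

open SlipChannel
theorem lemma3p2 (Ω : Channel) (c : CutoffFamily) :
    (∃ C : ℝ → ℝ → ℝ, ∀ ε d Φ : ℝ, 0 < ε → Ω.L < d →
      IntegrableOn (fun x => gradSq (carrier Ω c Φ ε d) x +
        convectionSq (carrier Ω c Φ ε d) x) Ω.domain ∧
      ∫ x in Ω.domain, (gradSq (carrier Ω c Φ ε d) x + convectionSq (carrier Ω c Φ ε d) x)
        ≤ C ε d * (Φ ^ 2 + Φ ^ 4)) ∧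
    (∀ Φ δ : ℝ, 0 < δ → ∃ ε₀ : ℝ, 0 < ε₀ ∧ ∀ ε : ℝ, 0 < ε → ε ≤ ε₀ →
      ∃ d₀ : ℝ, Ω.L < d₀ ∧ ∀ d : ℝ, d₀ ≤ d →
        ∀ (v : Fin 2 → ℝ × ℝ → ℝ) (A : Fin 2 → Fin 2 → ℝ × ℝ → ℝ), MemHσ Ω v A →
          IntegrableOn (trilinear v (carrier Ω c Φ ε d)) Ω.domain ∧
          |∫ x in Ω.domain, trilinear v (carrier Ω c Φ ε d) x|
            ≤ δ * ∫ x in Ω.domain, ∑ i, ∑ j, A i j x ^ 2) := by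
  refine ⟨?_, fun Φ δ hδ => trilinear_estimate Ω c hδ⟩
  -- The constant is quantified before `Φ` and before the constraints, so that `choose` yields a
  -- function of `ε` and `d` alone; inadmissible pairs receive the value `0`.
  have h : ∀ ε d : ℝ, ∃ C : ℝ, 0 < ε → Ω.L < d → ∀ Φ : ℝ,
      IntegrableOn (fun x => gradSq (carrier Ω c Φ ε d) x +
        convectionSq (carrier Ω c Φ ε d) x) Ω.domain ∧
      ∫ x in Ω.domain, (gradSq (carrier Ω c Φ ε d) x + convectionSq (carrier Ω c Φ ε d) x)
        ≤ C * (Φ ^ 2 + Φ ^ 4) := fun ε d => by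
    by_cases hεd : 0 < ε ∧ Ω.L < d
    · obtain ⟨C, hC⟩ := carrier_estimate Ω c hεd.1 hεd.2
      exact ⟨C, fun _ _ => hC⟩
    · exact ⟨0, fun h1 h2 => absurd ⟨h1, h2⟩ hεd⟩
  choose C hC using h
  exact ⟨C, fun ε d Φ hε hd => hC ε d hε hd Φ⟩
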